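/- **Setting.** In each period $t$ a buyer with identity $e_t$ and true feature $\tilde x_t^0\in\mathbb R^d$ arrives; put $x_t^0=(\tilde x_t^{0\top},1)^\top$. The valuation is $v_t=\theta_0^\top x_t^0+z_t$, where $\theta_0=(\beta_0^\top,\alpha_0)^\top\in\Theta=\{\theta\in\mathbb R^{d+1}:\|\theta\|_1\le W_\theta\}$ and the $z_t$ are i.i.d. with mean zero and known distribution function $F$, density $f=F'$. At price $p_t$ a sale occurs ($y_t=1$) iff $v_t\ge p_t$. Let $\phi(v)=v-\frac{1-F(v)}{f(v)}$, $g(v)=v+\phi^{-1}(-v)$; the oracle price is $p_t^*=g(\theta_0^\top x_t^0)$. **Assumptions.** (i) $\|x_t^0\|_2\le W_x$ a.s. (ii) $F$ is strictly increasing on $\mathbb R$, $F$ and $1-F$ are log-concave, $(\log(1-F))''<0$, and $f,f',f''$ exist and are bounded on every bounded interval. (iii) All $\tilde x_t^0$ have the same law, they are independent within each exploration phase (below), a returning buyer has the same true feature, and the smallest eigenvalue of $\Sigma=\mathbb E[x_t^0x_t^{0\top}]$ is at least $\lambda_{min}>0$. (iv) The marginal cost $A\in\mathbb R^{d\times d}$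 is symmetric positive definite with smallest eigenvalue $\lambda_{Amin}$, and is unknown to the seller. (v) Arrivals (identities, true and manipulated features), noise, and exploration prices are mutually independent; the exploration prices are i.i.d. uniform on $(0,B)$, $B>0$. **Algorithm.** Input: $B$, an integer $\ell_0\ge1$, and $0<C_a\le\ell_0$. Let $\ell_k=2^{k-1}\ell_0$ and $a_k=\lfloor\sqrt{C_a\ell_k}\rfloor$, $k\ge1$. Episode $k$ consists of the exploration phase $I_k=\{\ell_k,\dots,\ell_k+a_k-1\}$ and the exploitation phase $I_k'=\{\ell_k+a_k,\dots,\ell_{k+1}-1\}$; play starts in period $\ell_0$. *Exploration, $t\in I_k$:* the buyer reveals $\tilde x_t^0$ and $p_t$ is drawn uniformly from $(0,B)$. Then $\hat\theta_k=(\hat\beta_k^\top,\hat\alpha_k)^\top$ is a maximizer over $\Theta$ of the log-likelihood $$\frac1{a_k}\sum_{t\in I_k}\big\{\mathbb I(y_t=1)\log[1-F(p_t-\theta^\top x_t^0)]+\mathbb I(y_t=0)\log F(p_t-\theta^\top x_t^0)\big\}.$$ *Exploitation, $t\in I_k'$:* the buyer reveals $\tilde x_t$ satisfying $\tilde x_t=\tilde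 x_t^0-A^{-1}\beta_0\,g'(\theta_0^\top x_t)$, $x_t=(\tilde x_t^\top,1)^\top$. Identities and revealed features are recorded. A matched pair (true feature, manipulated feature) is obtained in each exploitation period whose buyer was previously recorded in an exploration period, and in each exploration period whose buyer was previously recorded in an exploitation period. If the buyer of period $t$ was recorded in an earlier exploration period, then $p_t=g(\hat\theta_k^\top x_t^0)$ with the recorded true feature. Otherwise, if there are no matched pairs yet, $p_t=g(\hat\theta_k^\top x_t)$; and if there are, $\gamma=-A^{-1}\beta_0$ is estimated by least squares over all matched pairs available, $$\hat\gamma=\frac{\sum_r u_r(\tilde x_r-\tilde x_r^0)}{\sum_r u_r^2},\qquad u_r=g'(\hat\theta_k^\top x_r),$$ and $p_t=g\big(\hat\theta_k^\top x_t-\hat\beta_k^\top\hat\gamma\,g'(\hat\theta_k^\top x_t)\big)$. **Repeat buyers.** The repeat buyer rate is at least $\tau\in(0,1]$: almost surely, at the end of every episode, among all arrivals so far, the proportion of those whose buyer has by then arrived both in an exploration and in an exploitation phase is at least $\tau$. **Theorem.** There are constants $C_3^*,C_4^*>0$, depending only on $F,B,W_x,W_\theta,\lambda_{min}$, on a positive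 lower bound for $\lambda_{Amin}$, on a positive lower bound for $C_a$ and on an upper bound for $\ell_0$, such that for every $d$, $A$, $\tau$, every $\theta_0\in\Theta$, every feature law and every market as above, and every number $T\ge1$ of periods, the regret $\sum_{t=\ell_0}^{\ell_0+T-1}[p_t^*\mathbb I(v_t\ge p_t^*)-p_t\mathbb I(v_t\ge p_t)]$ is integrable and $$\mathbb E\sum_{t=\ell_0}^{\ell_0+T-1}\big[p_t^*\,\mathbb I(v_t\ge p_t^*)-p_t\,\mathbb I(v_t\ge p_t)\big]<\Big[C_3^*+\frac{C_4^*\sqrt{d+1}}{\tau\lambda_{Amin}^2}\Big]\sqrt{(d+1)T}.$$ -/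

import Mathlib

open MeasureTheory ProbabilityTheory

namespace StrategicPricing

noncomputable section

/-! # The noise distribution and the pricing function -/

/-- The cumulative distribution function `F` of the noise law `ν`. -/
def noiseCDF (ν : Measure ℝ) : ℝ → ℝ := fun v => cdf ν v

/-- The density `f = F'`. -/
def noiseDensity (ν : Measure ℝ) : ℝ → ℝ := deriv (noiseCDF ν)

/-- The virtual valuation function `φ(v) = v - (1 - F(v)) / f(v)`. -/
def virtualValuation (ν : Measure ℝ) (v : ℝ) : ℝ :=
  v - (1 - noiseCDF ν v) / noiseDensity ν v

/-- The pricing function `g(v) = v + φ⁻¹(-v)`. (Under `NoiseAssumptions` below, `φ` is an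
increasing bijection of `ℝ`, so that `Function.invFun` is its inverse.) -/
def pricing (ν : Measure ℝ) (v : ℝ) : ℝ :=
  v + Function.invFun (virtualValuation ν) (-v)

/-- The assumptions on the noise: mean zero; `F` strictly increasing; `F` and `1 - F` log-concave;
`f`, `f'`, `f''` exist and are bounded on bounded intervals; the hazard rate
`-(log (1 - F))'` has a positive derivative. -/
structure NoiseAssumptions (ν : Measure ℝ) : Prop where
  integrable : Integrable (fun z : ℝ => z) ν
  mean_zero : ∫ z, z ∂ν = 0
  strictMono : StrictMono (noiseCDF ν)
  logConcave_cdf : ConcaveOn ℝ Set.univ (fun v => Real.log (noiseCDF ν v))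
  logConcave_survival : ConcaveOn ℝ Set.univ (fun v => Real.log (1 - noiseCDF ν v))
  differentiable_cdf : Differentiable ℝ (noiseCDF ν)
  differentiable_density : Differentiable ℝ (noiseDensity ν)
  differentiable_deriv_density : Differentiable ℝ (deriv (noiseDensity ν))
  bounded : ∀ R : ℝ, ∃ M : ℝ, ∀ v : ℝ, |v| ≤ R →
    |noiseDensity ν v| < M ∧ |deriv (noiseDensity ν) v| < M ∧
      |deriv (deriv (noiseDensity ν)) v| < M
  survival_curved : ∀ v : ℝ,
    deriv (deriv (fun w => Real.log (1 - noiseCDF ν w))) v < 0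

/-! # Features and preference parameters -/

variable {d : ℕ}

/-- The augmented feature `x = (x̃, 1) ∈ ℝ^(d+1)`. -/
def aug (x : Fin d → ℝ) : Fin (d + 1) → ℝ := Fin.snoc (α := fun _ => ℝ) x (1 : ℝ)

/-- The slope part `β ∈ ℝ^d` of a parameter `θ = (β, α) ∈ ℝ^(d+1)`. -/
def betaPart (θ : Fin (d + 1) → ℝ) : Fin d → ℝ := fun i => θ i.castSucc

/-- The linear score `θᵀ x`, where `x = (x̃, 1)`. -/
def score (θ : Fin (d + 1) → ℝ) (x : Fin d → ℝ) : ℝ := θ ⬝ᵥ aug x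

/-- The parameter set `Θ = {θ : ‖θ‖₁ ≤ W}`. -/
def paramSet (d : ℕ) (W : ℝ) : Set (Fin (d + 1) → ℝ) := {θ | ∑ i, |θ i| ≤ W}

/-- The matrix `Σ = E[x xᵀ]`, where `x = (x̃, 1)` and `x̃` has law `P`. -/
def secondMoment (P : Measure (Fin d → ℝ)) : Matrix (Fin (d + 1)) (Fin (d + 1)) ℝ :=
  Matrix.of fun i j => ∫ x, aug x i * aug x j ∂P

/-! # Maximum likelihood -/

/-- One observation of an exploration period: the feature, the posted price, and whether a sale
occurred. -/
abbrev Obs (d : ℕ) : Type := (Fin d → ℝ) × ℝ × Bool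

/-- The average log-likelihood of the parameter `θ` for `n` observations. -/
def logLik (ν : Measure ℝ) {n : ℕ} (data : Fin n → Obs d) (θ : Fin (d + 1) → ℝ) : ℝ :=
  (1 / (n : ℝ)) * ∑ i, if (data i).2.2 = true
    then Real.log (1 - noiseCDF ν ((data i).2.1 - score θ (data i).1))
    else Real.log (noiseCDF ν ((data i).2.1 - score θ (data i).1))

/-- `est` is a (measurable) maximum likelihood estimator over `Θ`: for every data set, it returns
a maximizer of the log-likelihood over `Θ`. -/
structure IsMLE (ν : Measure ℝ) (W : ℝ)
    (est : (n : ℕ) → (Fin n → Obs d) → (Fin (d + 1) → ℝ)) : Prop where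
  measurable : ∀ n, Measurable (est n)
  mem : ∀ n data, est n data ∈ paramSet d W
  isMax : ∀ n data, ∀ θ ∈ paramSet d W, logLik ν data θ ≤ logLik ν data (est n data)

/-! # Episodes -/

/-- The length `ℓ_k = 2^(k-1) ℓ₀` of episode `k ≥ 1`; it is also its first period. -/
def epLen (l₀ k : ℕ) : ℕ := 2 ^ (k - 1) * l₀

/-- The length `a_k = ⌊√(C_a ℓ_k)⌋` of the exploration phase of episode `k`. -/
def exploreLen (l₀ : ℕ) (Ca : ℝ) (k : ℕ) : ℕ := ⌊√(Ca * (epLen l₀ k : ℝ))⌋₊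

/-- The exploration phase `I_k = {ℓ_k, …, ℓ_k + a_k - 1}`. -/
def explorePhase (l₀ : ℕ) (Ca : ℝ) (k : ℕ) : Finset ℕ :=
  Finset.Ico (epLen l₀ k) (epLen l₀ k + exploreLen l₀ Ca k)

/-- The exploitation phase `I_k' = {ℓ_k + a_k, …, ℓ_(k+1) - 1}`. -/
def exploitPhase (l₀ : ℕ) (Ca : ℝ) (k : ℕ) : Finset ℕ :=
  Finset.Ico (epLen l₀ k + exploreLen l₀ Ca k) (epLen l₀ (k + 1))

/-- `t` is an exploration period. -/
def IsExplore (l₀ : ℕ) (Ca : ℝ) (t : ℕ) : Prop := ∃ k, 1 ≤ k ∧ t ∈ explorePhase l₀ Ca k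

/-- `t` is an exploitation period. -/
def IsExploit (l₀ : ℕ) (Ca : ℝ) (t : ℕ) : Prop := ∃ k, 1 ≤ k ∧ t ∈ exploitPhase l₀ Ca k

/-- The episode `k` with `ℓ_k ≤ t < ℓ_(k+1)`. -/
def episodeOf (l₀ t : ℕ) : ℕ := Nat.log 2 (t / l₀) + 1

theorem mem_episodeOf {l₀ t : ℕ} (h₀ : 0 < l₀) (ht : l₀ ≤ t) :
    epLen l₀ (episodeOf l₀ t) ≤ t ∧ t < epLen l₀ (episodeOf l₀ t + 1) := by
  have h1 : t / l₀ ≠ 0 := (Nat.div_pos ht h₀).ne'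
  have h2 := Nat.pow_log_le_self 2 h1
  have h3 := Nat.lt_pow_succ_log_self (b := 2) (by norm_num) (t / l₀)
  simp only [epLen, episodeOf, Nat.add_sub_cancel]
  exact ⟨(Nat.le_div_iff_mul_le h₀).1 h2, (Nat.div_lt_iff_lt_mul h₀).1 h3⟩

/-! # Sample paths and the algorithm -/

/-- One realization of everything that is exogenous to the seller. In period `t`: the identity
`e_t` of the arriving buyer, the true feature `x̃_t⁰`, the feature this buyer reveals if the
optimal pricing policy is in force, the valuation noise `z_t`, and the price drawn from the uniform
distribution, to be posted if `t` is an exploration period. -/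
structure Path (d : ℕ) where
  /-- the identity `e_t` -/
  ident : ℕ → ℕ
  /-- the true feature -/
  feat : ℕ → Fin d → ℝ
  /-- the manipulated feature -/
  manip : ℕ → Fin d → ℝ
  /-- the noise `z_t` -/
  noise : ℕ → ℝ
  /-- the uniform price -/
  unif : ℕ → ℝ

/-- The valuation `v_t = θ₀ᵀ x_t⁰ + z_t`. -/
def valuation (θ₀ : Fin (d + 1) → ℝ) (s : Path d) (t : ℕ) : ℝ := score θ₀ (s.feat t) + s.noise t

open scoped Classical in
/-- The observations of the exploration phase of episode `k`. Buyers reveal their true features,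
the price is uniform, and there is a sale if and only if the valuation is at least the price. -/
def exploreData (l₀ : ℕ) (Ca : ℝ) (θ₀ : Fin (d + 1) → ℝ) (s : Path d) (k : ℕ) :
    Fin (exploreLen l₀ Ca k) → Obs d :=
  fun i => (s.feat (epLen l₀ k + i), s.unif (epLen l₀ k + i),
    decide (s.unif (epLen l₀ k + i) ≤ valuation θ₀ s (epLen l₀ k + i)))

/-- The estimate `θ̂_k` computed at the end of the exploration phase of episode `k`. -/
def thetaHat (l₀ : ℕ) (Ca : ℝ) (est : (n : ℕ) → (Fin n → Obs d) → (Fin (d + 1) → ℝ))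
    (θ₀ : Fin (d + 1) → ℝ) (s : Path d) (k : ℕ) : Fin (d + 1) → ℝ :=
  est (exploreLen l₀ Ca k) (exploreData l₀ Ca θ₀ s k)

open scoped Classical in
/-- The records in `ℰ₁` of the buyer of period `t`: the earlier exploration periods in which this
buyer arrived. -/
def exploreRecords (l₀ : ℕ) (Ca : ℝ) (s : Path d) (t : ℕ) : Finset ℕ :=
  (Finset.range t).filter fun r => IsExplore l₀ Ca r ∧ s.ident r = s.ident t

open scoped Classical in
/-- The records in `ℰ₂` of the buyer of period `t`: the earlier exploitation periods in which this
buyer arrived. -/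
def exploitRecords (l₀ : ℕ) (Ca : ℝ) (s : Path d) (t : ℕ) : Finset ℕ :=
  (Finset.range t).filter fun r => IsExploit l₀ Ca r ∧ s.ident r = s.ident t

open scoped Classical in
/-- The periods before `t` in which a matched pair was added to `ℳ`: an exploitation period whose
buyer is in `ℰ₁`, or an exploration period whose buyer is in `ℰ₂`. -/
def matchTimes (l₀ : ℕ) (Ca : ℝ) (s : Path d) (t : ℕ) : Finset ℕ :=
  (Finset.range t).filter fun r =>
    (IsExploit l₀ Ca r ∧ (exploreRecords l₀ Ca s r).Nonempty) ∨
      (IsExplore l₀ Ca r ∧ (exploitRecords l₀ Ca s r).Nonempty)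

/-- The true feature that `ℰ₁` holds for the buyer of period `t` (the most recent record). -/
def recordedTrue (l₀ : ℕ) (Ca : ℝ) (s : Path d) (t : ℕ) : Fin d → ℝ :=
  s.feat ((exploreRecords l₀ Ca s t).sup id)

/-- The manipulated feature that `ℰ₂` holds for the buyer of period `t` (the most recent
record). -/
def recordedManip (l₀ : ℕ) (Ca : ℝ) (s : Path d) (t : ℕ) : Fin d → ℝ :=
  s.manip ((exploitRecords l₀ Ca s t).sup id)

open scoped Classical in
/-- The true feature in the matched pair added in period `r`. -/
def pairTrue (l₀ : ℕ) (Ca : ℝ) (s : Path d) (r : ℕ) : Fin d → ℝ :=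
  if IsExplore l₀ Ca r then s.feat r else recordedTrue l₀ Ca s r

open scoped Classical in
/-- The manipulated feature in the matched pair added in period `r`. -/
def pairManip (l₀ : ℕ) (Ca : ℝ) (s : Path d) (r : ℕ) : Fin d → ℝ :=
  if IsExplore l₀ Ca r then recordedManip l₀ Ca s r else s.manip r

/-- The least squares estimate `γ̂ = (∑ u_r²)⁻¹ ∑ u_r δ_r` over the matched pairs available in
period `t`, where `δ_r` is the difference between the manipulated feature `x̃_r` and the true
feature, and `u_r = g'(θᵀ x_r)`. -/
def gammaHat (ν : Measure ℝ) (l₀ : ℕ) (Ca : ℝ) (θ : Fin (d + 1) → ℝ) (s : Path d) (t : ℕ) :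
    Fin d → ℝ :=
  (∑ r ∈ matchTimes l₀ Ca s t, deriv (pricing ν) (score θ (pairManip l₀ Ca s r)) ^ 2)⁻¹ •
    ∑ r ∈ matchTimes l₀ Ca s t, deriv (pricing ν) (score θ (pairManip l₀ Ca s r)) •
      (pairManip l₀ Ca s r - pairTrue l₀ Ca s r)

open scoped Classical in
/-- The price of an exploitation period `t`, given the current estimate `θ = (β, α)`. If the buyer
is in `ℰ₁`, it is `g` at the score of the recorded true feature. Otherwise it is
`g(θᵀ x_t - βᵀ γ̂ g'(θᵀ x_t))` if there are matched pairs, and `g(θᵀ x_t)` if there are none. -/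
def exploitPrice (ν : Measure ℝ) (l₀ : ℕ) (Ca : ℝ) (θ : Fin (d + 1) → ℝ) (s : Path d) (t : ℕ) :
    ℝ :=
  if (exploreRecords l₀ Ca s t).Nonempty then
    pricing ν (score θ (recordedTrue l₀ Ca s t))
  else if (matchTimes l₀ Ca s t).Nonempty then
    pricing ν (score θ (s.manip t) -
      (betaPart θ ⬝ᵥ gammaHat ν l₀ Ca θ s t) * deriv (pricing ν) (score θ (s.manip t)))
  else
    pricing ν (score θ (s.manip t))

open scoped Classical in
/-- The price `p_t` posted by the algorithm. -/
def price (ν : Measure ℝ) (l₀ : ℕ) (Ca : ℝ)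
    (est : (n : ℕ) → (Fin n → Obs d) → (Fin (d + 1) → ℝ))
    (θ₀ : Fin (d + 1) → ℝ) (s : Path d) (t : ℕ) : ℝ :=
  if IsExplore l₀ Ca t then s.unif t
  else exploitPrice ν l₀ Ca (thetaHat l₀ Ca est θ₀ s (episodeOf l₀ t)) s t

/-- The oracle price `p_t* = g(θ₀ᵀ x_t⁰)`. -/
def oraclePrice (ν : Measure ℝ) (θ₀ : Fin (d + 1) → ℝ) (s : Path d) (t : ℕ) : ℝ :=
  pricing ν (score θ₀ (s.feat t))

open scoped Classical in
/-- The revenue from posting the price `p` to a buyer with valuation `v`. -/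
def revenue (p v : ℝ) : ℝ := if p ≤ v then p else 0

/-- The realized regret of the first `T` periods `ℓ₀, …, ℓ₀ + T - 1`. -/
def regret (ν : Measure ℝ) (l₀ : ℕ) (Ca : ℝ)
    (est : (n : ℕ) → (Fin n → Obs d) → (Fin (d + 1) → ℝ))
    (θ₀ : Fin (d + 1) → ℝ) (T : ℕ) (s : Path d) : ℝ :=
  ∑ t ∈ Finset.Ico l₀ (l₀ + T),
    (revenue (oraclePrice ν θ₀ s t) (valuation θ₀ s t) -
      revenue (price ν l₀ Ca est θ₀ s t) (valuation θ₀ s t))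

/-! # The stochastic model -/

open scoped Classical in
/-- The repeat buyer rate is at least `τ`: at the end of every episode, among all arrivals so far,
the proportion of those whose buyer has arrived both in an exploration phase and in an
exploitation phase is at least `τ`. -/
def RepeatRateAtLeast (l₀ : ℕ) (Ca : ℝ) (τ : ℝ) (s : Path d) : Prop :=
  ∀ k, 1 ≤ k →
    τ * ((Finset.Ico l₀ (epLen l₀ (k + 1))).card : ℝ) ≤
      (((Finset.Ico l₀ (epLen l₀ (k + 1))).filter fun t =>
        (∃ r ∈ Finset.Ico l₀ (epLen l₀ (k + 1)), IsExplore l₀ Ca r ∧ s.ident r = s.ident t) ∧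
        (∃ r ∈ Finset.Ico l₀ (epLen l₀ (k + 1)), IsExploit l₀ Ca r ∧ s.ident r = s.ident t)).card :
          ℝ)

/-- The random path `S` follows the model with noise law `ν`, price bound `B`, marginal cost `A`,
preference parameter `θ₀`, feature law `P` and repeat buyer rate at least `τ`. -/
structure IsMarket {Ω : Type*} [MeasurableSpace Ω] (μ : Measure Ω) (ν : Measure ℝ) (B : ℝ)
    (l₀ : ℕ) (Ca : ℝ) (A : Matrix (Fin d) (Fin d) ℝ) (θ₀ : Fin (d + 1) → ℝ)
    (P : Measure (Fin d → ℝ)) (τ : ℝ) (S : Ω → Path d) : Prop where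
  measurable_ident : ∀ t, Measurable fun ω => (S ω).ident t
  measurable_feat : ∀ t, Measurable fun ω => (S ω).feat t
  measurable_manip : ∀ t, Measurable fun ω => (S ω).manip t
  measurable_noise : ∀ t, Measurable fun ω => (S ω).noise t
  measurable_unif : ∀ t, Measurable fun ω => (S ω).unif t
  /-- True features have law `P`. -/
  feat_law : ∀ t, μ.map (fun ω => (S ω).feat t) = P
  /-- Within an exploration phase, true features are independent. -/
  feat_indep : ∀ k, 1 ≤ k →
    iIndepFun (fun (i : Fin (exploreLen l₀ Ca k)) ω => (S ω).feat (epLen l₀ k + i)) μ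
  /-- A returning buyer has the same true feature. -/
  feat_ident : ∀ r t, ∀ᵐ ω ∂μ, (S ω).ident r = (S ω).ident t → (S ω).feat r = (S ω).feat t
  /-- In exploitation periods, `x̃_t = x̃_t⁰ - A⁻¹ β₀ g'(θ₀ᵀ x_t)`. -/
  manip_eq : ∀ t, IsExploit l₀ Ca t → ∀ᵐ ω ∂μ,
    (S ω).manip t =
      (S ω).feat t - deriv (pricing ν) (score θ₀ ((S ω).manip t)) • (A⁻¹.mulVec (betaPart θ₀))
  repeat_rate : ∀ᵐ ω ∂μ, RepeatRateAtLeast l₀ Ca τ (S ω)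
  noise_law : ∀ t, μ.map (fun ω => (S ω).noise t) = ν
  noise_indep : iIndepFun (fun t ω => (S ω).noise t) μ
  /-- Exploration prices are uniform on `(0, B)`. -/
  unif_law : ∀ t, μ.map (fun ω => (S ω).unif t) = ProbabilityTheory.cond volume (Set.Ioo 0 B)
  unif_indep : iIndepFun (fun t ω => (S ω).unif t) μ
  noise_indep_unif : IndepFun (fun ω => (S ω).noise) (fun ω => (S ω).unif) μ
  /-- Arrivals and features are independent of the noise and of the exploration prices. -/
  arrivals_indep : IndepFun (fun ω => ((S ω).ident, (S ω).feat, (S ω).manip))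
    (fun ω => ((S ω).noise, (S ω).unif)) μ

end

end StrategicPricing

namespace StrategicPricing

noncomputable section

/-! # Consequences of the noise assumptions -/

namespace NoiseAssumptions

variable {ν : Measure ℝ}

/-! The regret is already O(√T) with a constant that depends on neither `d` nor `τ`; the remaining
factors of the claimed bound are room. Four facts carry this.

Loss is quadratic in the pricing error: `g(q)` is the critical point of `p ↦ p (1 - F(p - q))`, so
the expected loss at price `p` is O((p - g(q))²) (`exists_expected_revenue_sub_le`). This applies in
an exploitation period because its price uses no noise from that period on, so the current noise can
be integrated out (`price_truncNoise`, `integral_revenue_sub_eq`).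

The estimator has mean squared error O(1/a_k) (`exists_integral_sq_thetaHat_le`). The term `-log F`
is merely convex, but `-log (1 - F)` is uniformly convex on bounded intervals, and noise above `b =
B + W Wx` forces a sale. Hence the log-likelihood has curvature at least that of an empirical second
moment matrix with mean `P(z ≥ b) Σ`. The gradient at `θ₀` and the deviation of this matrix are
averages of pairwise independent bounded variables, so Chebyshev-type second moments suffice. The
dimension is absorbed, since `(d + 1) λ_min ≤ tr Σ ≤ Wx²`.

Least squares adds no statistical error of its own. Each matched pair satisfies `x̃ - x̃⁰ = -g'(θ₀ᵀ
x) A⁻¹ β₀` exactly, so the estimate is an exact multiple of `A⁻¹ β₀`, and its factor differs from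
`-1` by O(‖θ̂ - θ₀‖) (`exists_gammaHat_eq`). A single pair is enough, and a positive repeat rate at
the end of the first episode supplies one. The pricing error is therefore O(‖θ̂ - θ₀‖) from period
`2 ℓ₀` on (`exists_abs_exploitPrice_sub_le`).

An exploitation period `t ≥ 2 ℓ₀` of episode `k` thus costs O(1/a_k) = O(1/√t). Exploration periods
number O(√T), the first episode has bounded length, and all prices are bounded, so the sum is O(√T)
(`sum_Ico_le_mul_sqrt`). -/

theorem cdf_lt_one (hν : NoiseAssumptions ν) (v : ℝ) : noiseCDF ν v < 1 :=
  (hν.strictMono (lt_add_one v)).trans_le (cdf_le_one ν _)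

theorem cdf_pos (hν : NoiseAssumptions ν) (v : ℝ) : 0 < noiseCDF ν v :=
  (cdf_nonneg ν (v - 1)).trans_lt (hν.strictMono (sub_one_lt v))

theorem hasDerivAt_cdf (hν : NoiseAssumptions ν) (v : ℝ) :
    HasDerivAt (noiseCDF ν) (noiseDensity ν v) v :=
  (hν.differentiable_cdf v).hasDerivAt

theorem hasDerivAt_density (hν : NoiseAssumptions ν) (v : ℝ) :
    HasDerivAt (noiseDensity ν) (deriv (noiseDensity ν) v) v :=
  (hν.differentiable_density v).hasDerivAt

theorem hasDerivAt_deriv_density (hν : NoiseAssumptions ν) (v : ℝ) :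
    HasDerivAt (deriv (noiseDensity ν)) (deriv (deriv (noiseDensity ν)) v) v :=
  (hν.differentiable_deriv_density v).hasDerivAt

theorem continuous_cdf (hν : NoiseAssumptions ν) : Continuous (noiseCDF ν) :=
  hν.differentiable_cdf.continuous

theorem continuous_density (hν : NoiseAssumptions ν) : Continuous (noiseDensity ν) :=
  hν.differentiable_density.continuous

theorem continuous_deriv_density (hν : NoiseAssumptions ν) :
    Continuous (deriv (noiseDensity ν)) :=
  hν.differentiable_deriv_density.continuous

theorem density_nonneg (hν : NoiseAssumptions ν) (v : ℝ) : 0 ≤ noiseDensity ν v :=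
  hν.strictMono.monotone.deriv_nonneg

end NoiseAssumptions

/-- The hazard rate `f / (1 - F)`. -/
def hazard (ν : Measure ℝ) (v : ℝ) : ℝ := noiseDensity ν v / (1 - noiseCDF ν v)

/-- The derivative of the hazard rate. -/
def hazardDeriv (ν : Measure ℝ) (v : ℝ) : ℝ :=
  (deriv (noiseDensity ν) v * (1 - noiseCDF ν v) + noiseDensity ν v ^ 2) /
    (1 - noiseCDF ν v) ^ 2

/-! ### Positivity and monotonicity of the hazard rate. -/

namespace NoiseAssumptions

variable {ν : Measure ℝ}

theorem hasDerivAt_log_survival (hν : NoiseAssumptions ν) (v : ℝ) :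
    HasDerivAt (fun w => Real.log (1 - noiseCDF ν w)) (-hazard ν v) v := by
  have h := ((hν.hasDerivAt_cdf v).const_sub 1).log (sub_pos.2 (hν.cdf_lt_one v)).ne'
  simpa [hazard, neg_div] using h

theorem hasDerivAt_hazard (hν : NoiseAssumptions ν) (v : ℝ) :
    HasDerivAt (hazard ν) (hazardDeriv ν v) v := by
  have h := (hν.hasDerivAt_density v).div ((hν.hasDerivAt_cdf v).const_sub 1)
    (sub_pos.2 (hν.cdf_lt_one v)).ne'
  have e : hazardDeriv ν v = (deriv (noiseDensity ν) v * (1 - noiseCDF ν v) -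
      noiseDensity ν v * -noiseDensity ν v) / (1 - noiseCDF ν v) ^ 2 := by
    rw [hazardDeriv]; ring
  rw [e]; exact h

theorem hazardDeriv_pos (hν : NoiseAssumptions ν) (v : ℝ) : 0 < hazardDeriv ν v := by
  have h := hν.survival_curved v
  have e : deriv (fun w => Real.log (1 - noiseCDF ν w)) = fun w => -hazard ν w :=
    funext fun w => (hν.hasDerivAt_log_survival w).deriv
  rw [e, (hν.hasDerivAt_hazard v).fun_neg.deriv] at h
  linarith

theorem continuous_hazardDeriv (hν : NoiseAssumptions ν) : Continuous (hazardDeriv ν) := by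
  unfold hazardDeriv
  have h1 := hν.continuous_cdf
  have h2 := hν.continuous_density
  have h3 := hν.continuous_deriv_density
  exact Continuous.div₀ (by fun_prop) (by fun_prop)
    fun v => pow_ne_zero _ (sub_pos.2 (hν.cdf_lt_one v)).ne'

theorem hazard_strictMono (hν : NoiseAssumptions ν) : StrictMono (hazard ν) :=
  strictMono_of_deriv_pos fun v => by
    rw [(hν.hasDerivAt_hazard v).deriv]; exact hν.hazardDeriv_pos v

/-- A nonnegative strictly increasing function has no zero. This is where positivity of the density
comes from: strict monotonicity of `F` alone would allow isolated zeros of `f`. -/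
theorem hazard_pos (hν : NoiseAssumptions ν) (v : ℝ) : 0 < hazard ν v :=
  (div_nonneg (hν.density_nonneg (v - 1)) (sub_pos.2 (hν.cdf_lt_one _)).le).trans_lt
    (hν.hazard_strictMono (sub_one_lt v))

theorem density_pos (hν : NoiseAssumptions ν) (v : ℝ) : 0 < noiseDensity ν v := by
  refine (hν.density_nonneg v).lt_of_ne fun h => ?_
  have := hν.hazard_pos v
  rw [hazard, ← h, zero_div] at this
  exact this.false

end NoiseAssumptions

/-- The derivative `φ' = 2 + f' (1 - F) / f²` of the virtual valuation function. -/
def virtualDeriv (ν : Measure ℝ) (v : ℝ) : ℝ :=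
  2 + deriv (noiseDensity ν) v * (1 - noiseCDF ν v) / noiseDensity ν v ^ 2

/-! ### The virtual valuation as an expanding bijection. -/

namespace NoiseAssumptions

variable {ν : Measure ℝ}

theorem hasDerivAt_virtualValuation (hν : NoiseAssumptions ν) (v : ℝ) :
    HasDerivAt (virtualValuation ν) (virtualDeriv ν v) v := by
  have hf := (hν.density_pos v).ne'
  have h := (hasDerivAt_id v).sub (((hν.hasDerivAt_cdf v).const_sub 1).div
    (hν.hasDerivAt_density v) hf)
  have e : virtualDeriv ν v = 1 - (-noiseDensity ν v * noiseDensity ν v -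
      (1 - noiseCDF ν v) * deriv (noiseDensity ν) v) / noiseDensity ν v ^ 2 := by
    rw [virtualDeriv]; field_simp; ring
  rw [e]; exact h

/-- `φ' - 1 = h' (1 - F)² / f²`, where `h` is the hazard rate. It follows that `φ⁻¹` does not expand
distances and that `g' = 1 - 1/φ'` lies in `(0, 1)`. -/
theorem one_lt_virtualDeriv (hν : NoiseAssumptions ν) (v : ℝ) : 1 < virtualDeriv ν v := by
  have h := hν.hazardDeriv_pos v
  have hf := hν.density_pos v
  have hF : 0 < 1 - noiseCDF ν v := sub_pos.2 (hν.cdf_lt_one v)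
  rw [hazardDeriv, lt_div_iff₀ (by positivity), zero_mul] at h
  have e : virtualDeriv ν v - 1 = (deriv (noiseDensity ν) v * (1 - noiseCDF ν v) +
      noiseDensity ν v ^ 2) / noiseDensity ν v ^ 2 := by
    rw [virtualDeriv]; field_simp; ring
  have : 0 < virtualDeriv ν v - 1 := e ▸ by positivity
  linarith

theorem continuous_virtualDeriv (hν : NoiseAssumptions ν) : Continuous (virtualDeriv ν) := by
  unfold virtualDeriv
  have h1 := hν.continuous_cdf
  have h2 := hν.continuous_density
  have h3 := hν.continuous_deriv_density
  exact continuous_const.add (Continuous.div₀ (by fun_prop) (by fun_prop)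
    fun v => pow_ne_zero _ (hν.density_pos v).ne')

theorem continuous_virtualValuation (hν : NoiseAssumptions ν) :
    Continuous (virtualValuation ν) :=
  continuous_iff_continuousAt.2 fun v => (hν.hasDerivAt_virtualValuation v).continuousAt

theorem sub_le_virtualValuation_sub (hν : NoiseAssumptions ν) {a b : ℝ} (h : a ≤ b) :
    b - a ≤ virtualValuation ν b - virtualValuation ν a := by
  have hm : Monotone fun v => virtualValuation ν v - v := by
    refine monotone_of_deriv_nonneg
      (fun v => ((hν.hasDerivAt_virtualValuation v).sub (hasDerivAt_id v)).differentiableAt)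
      fun v => ?_
    have := ((hν.hasDerivAt_virtualValuation v).fun_sub (hasDerivAt_id' v)).deriv
    rw [this]
    linarith [hν.one_lt_virtualDeriv v]
  have := hm h
  simp only at this
  linarith

theorem abs_sub_le_virtualValuation (hν : NoiseAssumptions ν) (a b : ℝ) :
    |a - b| ≤ |virtualValuation ν a - virtualValuation ν b| := by
  rcases le_total a b with h | h
  · have := hν.sub_le_virtualValuation_sub h
    rw [abs_sub_comm, abs_sub_comm (virtualValuation ν a), abs_of_nonneg (sub_nonneg.2 h)]
    exact this.trans (le_abs_self _)
  · have := hν.sub_le_virtualValuation_sub h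
    rw [abs_of_nonneg (sub_nonneg.2 h)]
    exact this.trans (le_abs_self _)

theorem bijective_virtualValuation (hν : NoiseAssumptions ν) :
    Function.Bijective (virtualValuation ν) := by
  refine ⟨fun a b h => ?_, ?_⟩
  · have := hν.abs_sub_le_virtualValuation a b
    rw [h, sub_self, abs_zero] at this
    exact sub_eq_zero.1 (abs_eq_zero.1 (le_antisymm this (abs_nonneg _)))
  · refine hν.continuous_virtualValuation.surjective ?_ ?_
    · refine Filter.tendsto_atTop_mono' _ ?_
        (Filter.tendsto_atTop_add_const_left _ (virtualValuation ν 0) Filter.tendsto_id)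
      filter_upwards [Filter.eventually_ge_atTop 0] with v hv
      have := hν.sub_le_virtualValuation_sub hv
      simp only [id]; linarith
    · refine Filter.tendsto_atBot_mono' _ ?_
        (Filter.tendsto_atBot_add_const_left _ (virtualValuation ν 0) Filter.tendsto_id)
      filter_upwards [Filter.eventually_le_atBot 0] with v hv
      have := hν.sub_le_virtualValuation_sub hv
      simp only [id]; linarith

end NoiseAssumptions

/-- The inverse of the virtual valuation function. -/
def virtualInv (ν : Measure ℝ) : ℝ → ℝ := Function.invFun (virtualValuation ν)

/-! ### The derivative of the pricing function. -/

namespace NoiseAssumptions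

variable {ν : Measure ℝ}

theorem virtualValuation_virtualInv (hν : NoiseAssumptions ν) (v : ℝ) :
    virtualValuation ν (virtualInv ν v) = v :=
  Function.rightInverse_invFun hν.bijective_virtualValuation.surjective v

theorem abs_virtualInv_sub_le (hν : NoiseAssumptions ν) (a b : ℝ) :
    |virtualInv ν a - virtualInv ν b| ≤ |a - b| := by
  simpa only [hν.virtualValuation_virtualInv] using
    hν.abs_sub_le_virtualValuation (virtualInv ν a) (virtualInv ν b)

theorem continuous_virtualInv (hν : NoiseAssumptions ν) : Continuous (virtualInv ν) :=
  LipschitzWith.continuous (K := 1) <| LipschitzWith.of_dist_le_mul fun a b => by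
    simpa [Real.dist_eq] using hν.abs_virtualInv_sub_le a b

theorem hasDerivAt_virtualInv (hν : NoiseAssumptions ν) (v : ℝ) :
    HasDerivAt (virtualInv ν) (virtualDeriv ν (virtualInv ν v))⁻¹ v :=
  HasDerivAt.of_local_left_inverse hν.continuous_virtualInv.continuousAt
    (hν.hasDerivAt_virtualValuation _)
    (by linarith [hν.one_lt_virtualDeriv (virtualInv ν v)])
    (Filter.Eventually.of_forall hν.virtualValuation_virtualInv)

theorem pricing_eq (v : ℝ) : pricing ν v = v + virtualInv ν (-v) := rfl

theorem hasDerivAt_pricing (hν : NoiseAssumptions ν) (v : ℝ) :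
    HasDerivAt (pricing ν) (1 - (virtualDeriv ν (virtualInv ν (-v)))⁻¹) v := by
  have h := (hasDerivAt_id v).add ((hν.hasDerivAt_virtualInv (-v)).comp v (hasDerivAt_neg v))
  have e : 1 - (virtualDeriv ν (virtualInv ν (-v)))⁻¹ =
    1 + (virtualDeriv ν (virtualInv ν (-v)))⁻¹ * -1 := by ring
  rw [e]; exact h

theorem deriv_pricing (hν : NoiseAssumptions ν) (v : ℝ) :
    deriv (pricing ν) v = 1 - (virtualDeriv ν (virtualInv ν (-v)))⁻¹ :=
  (hν.hasDerivAt_pricing v).deriv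

theorem continuous_pricing (hν : NoiseAssumptions ν) : Continuous (pricing ν) :=
  continuous_iff_continuousAt.2 fun v => (hν.hasDerivAt_pricing v).continuousAt

theorem continuous_deriv_pricing (hν : NoiseAssumptions ν) : Continuous (deriv (pricing ν)) := by
  rw [funext hν.deriv_pricing]
  have h1 := hν.continuous_virtualInv
  have h2 := hν.continuous_virtualDeriv
  exact continuous_const.sub (Continuous.inv₀ (by fun_prop)
    fun v => by linarith [hν.one_lt_virtualDeriv (virtualInv ν (-v))])

theorem deriv_pricing_pos (hν : NoiseAssumptions ν) (v : ℝ) : 0 < deriv (pricing ν) v := by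
  rw [hν.deriv_pricing]
  exact sub_pos.2 (inv_lt_one_of_one_lt₀ (hν.one_lt_virtualDeriv _))

theorem deriv_pricing_le_one (hν : NoiseAssumptions ν) (v : ℝ) : deriv (pricing ν) v ≤ 1 := by
  rw [hν.deriv_pricing]
  have : 0 < virtualDeriv ν (virtualInv ν (-v)) := by
    linarith [hν.one_lt_virtualDeriv (virtualInv ν (-v))]
  have := inv_pos.2 this
  linarith

theorem abs_pricing_sub_le (hν : NoiseAssumptions ν) (a b : ℝ) :
    |pricing ν a - pricing ν b| ≤ |a - b| := by
  have := Convex.norm_image_sub_le_of_norm_deriv_le (f := pricing ν) (C := 1) (s := Set.univ)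
    (x := b) (y := a) (fun v _ => (hν.hasDerivAt_pricing v).differentiableAt) (fun v _ => by
      rw [Real.norm_eq_abs, abs_of_pos (hν.deriv_pricing_pos v)]
      exact hν.deriv_pricing_le_one v) convex_univ trivial trivial
  simpa using this

/-- Keeps the regressors `u_r` of the least squares step away from zero. -/
theorem exists_deriv_pricing_lower (hν : NoiseAssumptions ν) {R : ℝ} (hR : 0 ≤ R) :
    ∃ m, 0 < m ∧ ∀ v, |v| ≤ R → m ≤ deriv (pricing ν) v := by
  obtain ⟨x, -, hx⟩ := (isCompact_Icc (a := -R) (b := R)).exists_isMinOn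
    ⟨0, by simpa using hR⟩ hν.continuous_deriv_pricing.continuousOn
  exact ⟨_, hν.deriv_pricing_pos x, fun v hv => hx (abs_le.1 hv)⟩

end NoiseAssumptions

theorem _root_.Continuous.exists_abs_le_of_abs_le {f : ℝ → ℝ} (hf : Continuous f) (R : ℝ) :
    ∃ C, 0 < C ∧ ∀ v, |v| ≤ R → |f v| ≤ C := by
  obtain ⟨C, hC⟩ := (isCompact_Icc (a := -R) (b := R)).exists_bound_of_continuousOn hf.continuousOn
  exact ⟨max C 1, by positivity, fun v hv => (hC v (abs_le.1 hv)).trans (le_max_left _ _)⟩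

theorem _root_.abs_sub_le_of_abs_hasDerivAt_le {f f' : ℝ → ℝ} (hf : ∀ v, HasDerivAt f (f' v) v)
    {R C : ℝ} (h : ∀ v, |v| ≤ R → |f' v| ≤ C) {a b : ℝ} (ha : |a| ≤ R) (hb : |b| ≤ R) :
    |f a - f b| ≤ C * |a - b| := by
  have := Convex.norm_image_sub_le_of_norm_hasDerivWithin_le (f := f) (f' := f') (C := C)
    (s := Set.Icc (-R) R) (x := b) (y := a) (fun v _ => (hf v).hasDerivWithinAt)
    (fun v hv => h v (abs_le.2 hv)) (convex_Icc _ _) (abs_le.1 hb) (abs_le.1 ha)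
  simpa using this

/-! ### Local Lipschitz bounds for `φ'` and `g'`, and the loss of revenue. -/

namespace NoiseAssumptions

variable {ν : Measure ℝ}

theorem hasDerivAt_virtualDeriv (hν : NoiseAssumptions ν) (v : ℝ) :
    HasDerivAt (virtualDeriv ν)
      ((deriv (deriv (noiseDensity ν)) v * (1 - noiseCDF ν v) -
        deriv (noiseDensity ν) v * noiseDensity ν v) / noiseDensity ν v ^ 2 -
        2 * deriv (noiseDensity ν) v ^ 2 * (1 - noiseCDF ν v) / noiseDensity ν v ^ 3) v := by
  have hf := (hν.density_pos v).ne'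
  have h := ((((hν.hasDerivAt_deriv_density v).mul ((hν.hasDerivAt_cdf v).const_sub 1)).div
    ((hν.hasDerivAt_density v).pow 2) (pow_ne_zero 2 hf))).const_add 2
  refine h.congr_deriv ?_
  simp only [Pi.mul_apply, Pi.pow_apply]
  field_simp
  push_cast
  ring

/-- The derivative of `φ'` contains `f''`, which is bounded on bounded intervals but need not be
continuous. It is split into `f''` times a continuous function and a continuous remainder, the
latter bounded by compactness. -/
theorem exists_lipschitz_virtualDeriv (hν : NoiseAssumptions ν) (R : ℝ) :
    ∃ C, 0 < C ∧ ∀ a b, |a| ≤ R → |b| ≤ R →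
      |virtualDeriv ν a - virtualDeriv ν b| ≤ C * |a - b| := by
  obtain ⟨M, hM⟩ := hν.bounded R
  have h1 := hν.continuous_cdf
  have h2 := hν.continuous_density
  have h3 := hν.continuous_deriv_density
  have hf : ∀ v, noiseDensity ν v ≠ 0 := fun v => (hν.density_pos v).ne'
  obtain ⟨C₁, hC₁, hC₁'⟩ := (Continuous.div₀ (f := fun v => 1 - noiseCDF ν v)
    (g := fun v => noiseDensity ν v ^ 2) (by fun_prop) (by fun_prop)
    fun v => pow_ne_zero _ (hf v)).exists_abs_le_of_abs_le R
  obtain ⟨C₂, hC₂, hC₂'⟩ := ((Continuous.div₀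
    (f := fun v => deriv (noiseDensity ν) v * noiseDensity ν v)
    (g := fun v => noiseDensity ν v ^ 2) (by fun_prop) (by fun_prop)
    fun v => pow_ne_zero _ (hf v)).add (Continuous.div₀
    (f := fun v => 2 * deriv (noiseDensity ν) v ^ 2 * (1 - noiseCDF ν v))
    (g := fun v => noiseDensity ν v ^ 3) (by fun_prop) (by fun_prop)
    fun v => pow_ne_zero _ (hf v))).exists_abs_le_of_abs_le R
  refine ⟨|M| * C₁ + C₂, by positivity, fun a b ha hb =>
    abs_sub_le_of_abs_hasDerivAt_le hν.hasDerivAt_virtualDeriv (fun v hv => ?_) ha hb⟩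
  have e1 := hC₁' v hv
  have e2 := hC₂' v hv
  have e3 := (hM v hv).2.2.le.trans (le_abs_self M)
  have e : (deriv (deriv (noiseDensity ν)) v * (1 - noiseCDF ν v) -
        deriv (noiseDensity ν) v * noiseDensity ν v) / noiseDensity ν v ^ 2 -
        2 * deriv (noiseDensity ν) v ^ 2 * (1 - noiseCDF ν v) / noiseDensity ν v ^ 3 =
      deriv (deriv (noiseDensity ν)) v * ((1 - noiseCDF ν v) / noiseDensity ν v ^ 2) -
      (deriv (noiseDensity ν) v * noiseDensity ν v / noiseDensity ν v ^ 2 +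
        2 * deriv (noiseDensity ν) v ^ 2 * (1 - noiseCDF ν v) / noiseDensity ν v ^ 3) := by
    ring
  rw [e]
  refine (abs_sub _ _).trans (add_le_add ?_ e2)
  rw [abs_mul]
  exact mul_le_mul e3 e1 (abs_nonneg _) (abs_nonneg _)

/-- Since `φ' > 1`, passing to reciprocals does not enlarge differences. The bound compares `g'` at
estimated and at true scores of the same feature. -/
theorem exists_lipschitz_deriv_pricing (hν : NoiseAssumptions ν) (R : ℝ) :
    ∃ C, 0 < C ∧ ∀ a b, |a| ≤ R → |b| ≤ R →
      |deriv (pricing ν) a - deriv (pricing ν) b| ≤ C * |a - b| := by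
  obtain ⟨R', -, hR'⟩ := hν.continuous_virtualInv.exists_abs_le_of_abs_le R
  obtain ⟨C, hC, hC'⟩ := hν.exists_lipschitz_virtualDeriv R'
  refine ⟨C, hC, fun a b ha hb => ?_⟩
  rw [hν.deriv_pricing, hν.deriv_pricing]
  set x := virtualInv ν (-a)
  set y := virtualInv ν (-b)
  have hx := hν.one_lt_virtualDeriv x
  have hy := hν.one_lt_virtualDeriv y
  have h1 : |virtualDeriv ν x - virtualDeriv ν y| ≤ C * |x - y| :=
    hC' x y (hR' _ (by rwa [abs_neg])) (hR' _ (by rwa [abs_neg]))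
  have h2 : |x - y| ≤ |a - b| := by
    refine (hν.abs_virtualInv_sub_le (-a) (-b)).trans_eq ?_
    rw [abs_sub_comm a b]; congr 1; ring
  have e : 1 - (virtualDeriv ν x)⁻¹ - (1 - (virtualDeriv ν y)⁻¹) =
      (virtualDeriv ν x - virtualDeriv ν y) / (virtualDeriv ν x * virtualDeriv ν y) := by
    have := (zero_lt_one.trans hx).ne'
    have := (zero_lt_one.trans hy).ne'
    field_simp
    ring
  rw [e, abs_div]
  have h3 : 1 ≤ |virtualDeriv ν x * virtualDeriv ν y| := by
    rw [abs_of_pos (by positivity)]; nlinarith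
  calc _ ≤ |virtualDeriv ν x - virtualDeriv ν y| := div_le_self (abs_nonneg _) h3
    _ ≤ C * |x - y| := h1
    _ ≤ C * |a - b| := by gcongr

/-! ### The expected revenue -/

/-- The expected revenue `p (1 - F (p - q))` from the price `p` at the score `q` is within a
constant times `(p - g(q))²` of the one from `g(q)`. -/
theorem exists_expected_revenue_sub_le (hν : NoiseAssumptions ν) (R : ℝ) :
    ∃ C, 0 < C ∧ ∀ p q, |p - q| ≤ R → |pricing ν q - q| ≤ R →
      pricing ν q * (1 - noiseCDF ν (pricing ν q - q)) - p * (1 - noiseCDF ν (p - q)) ≤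
        C * (p - pricing ν q) ^ 2 := by
  obtain ⟨C₁, hC₁, hC₁'⟩ := hν.continuous_density.exists_abs_le_of_abs_le R
  obtain ⟨C₂, hC₂, hC₂'⟩ := hν.continuous_virtualDeriv.exists_abs_le_of_abs_le R
  refine ⟨C₁ * C₂, by positivity, fun p q hp hq => ?_⟩
  set s := pricing ν q with hs
  -- The first-order condition: the derivative of the expected revenue at `x` is `-f(x - q) (φ(x -
  -- q) + q)`, which vanishes at `x = s`.
  have hφ : virtualValuation ν (s - q) = -q := by
    rw [hs, pricing_eq, add_sub_cancel_left, hν.virtualValuation_virtualInv]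
  have hd : ∀ x, HasDerivAt (fun x => x * (1 - noiseCDF ν (x - q)))
      (-noiseDensity ν (x - q) *
        (virtualValuation ν (x - q) - virtualValuation ν (s - q))) x := by
    intro x
    have h1 : HasDerivAt (fun x => noiseCDF ν (x - q)) (noiseDensity ν (x - q)) x :=
      HasDerivAt.comp_sub_const x q (hν.hasDerivAt_cdf (x - q))
    refine ((hasDerivAt_id x).mul (h1.const_sub 1)).congr_deriv ?_
    have hf := (hν.density_pos (x - q)).ne'
    rw [hφ, virtualValuation]
    field_simp
    simp only [id]
    ring
  -- Between `s` and `p` the derivative is at most `C₁ C₂ |p - s|`; the mean value inequality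
  -- contributes the second factor `|p - s|`.
  have key := Convex.norm_image_sub_le_of_norm_hasDerivWithin_le
    (f := fun x => x * (1 - noiseCDF ν (x - q))) (s := Set.uIcc s p) (x := p) (y := s)
    (C := C₁ * (C₂ * |p - s|))
    (fun v _ => (hd v).hasDerivWithinAt) (fun x hx => ?_) (convex_uIcc _ _)
    Set.right_mem_uIcc Set.left_mem_uIcc
  · refine (le_abs_self _).trans (key.trans_eq ?_)
    rw [Real.norm_eq_abs, abs_sub_comm s p, ← sq_abs (p - s)]; ring
  · have hxR : |x - q| ≤ R := by
      rw [abs_le] at hp hq ⊢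
      rcases Set.mem_uIcc.1 hx with h | h <;> constructor <;> linarith [h.1, h.2]
    rw [Real.norm_eq_abs, abs_mul, abs_neg]
    refine mul_le_mul (hC₁' _ hxR) ?_ (abs_nonneg _) hC₁.le
    refine (abs_sub_le_of_abs_hasDerivAt_le hν.hasDerivAt_virtualValuation hC₂' hxR hq).trans ?_
    refine mul_le_mul_of_nonneg_left ?_ hC₂.le
    rw [sub_sub_sub_cancel_right]
    exact Set.abs_sub_left_of_mem_uIcc hx

/-! ### Curvature of the log-likelihood -/

/-- The curvature of `-log (1 - F)` on a bounded interval. -/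
theorem exists_neg_log_survival_ge (hν : NoiseAssumptions ν) {R : ℝ} (hR : 0 ≤ R) :
    ∃ m, 0 < m ∧ ∀ u v, |u| ≤ R → |v| ≤ R →
      -Real.log (1 - noiseCDF ν v) + hazard ν v * (u - v) + m * (u - v) ^ 2 ≤
        -Real.log (1 - noiseCDF ν u) := by
  obtain ⟨x, -, hx⟩ := (isCompact_Icc (a := -R) (b := R)).exists_isMinOn
    ⟨0, by simpa using hR⟩ hν.continuous_hazardDeriv.continuousOn
  set m := hazardDeriv ν x with hm
  have hmpos : 0 < m := hν.hazardDeriv_pos x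
  refine ⟨m / 2, by positivity, fun u v hu hv => ?_⟩
  -- With `m` the minimum of the hazard derivative, removing `m w² / 2` still leaves a convex
  -- function. Its tangent inequality at `v` gives the claim, because `(u² - v²) / 2 - v (u - v) =
  -- (u - v)² / 2`.
  set f : ℝ → ℝ := fun w => -Real.log (1 - noiseCDF ν w) - m / 2 * w ^ 2 with hf
  have hf' : ∀ w, HasDerivAt f (hazard ν w - m * w) w := fun w => by
    have := (hν.hasDerivAt_log_survival w).fun_neg.fun_sub (((hasDerivAt_pow 2 w)).const_mul (m / 2))
    refine this.congr_deriv ?_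
    push_cast; ring
  have hmono : MonotoneOn (fun w => hazard ν w - m * w) (Set.Icc (-R) R) := by
    have hd : ∀ w, HasDerivAt (fun w => hazard ν w - m * w) (hazardDeriv ν w - m) w := fun w => by
      have := (hν.hasDerivAt_hazard w).fun_sub ((hasDerivAt_id' w).const_mul m)
      simpa using this
    refine monotoneOn_of_deriv_nonneg (convex_Icc _ _)
      (fun w _ => (hd w).continuousAt.continuousWithinAt)
      (fun w _ => (hd w).differentiableAt.differentiableWithinAt) fun w hw => ?_
    rw [(hd w).deriv]
    exact sub_nonneg.2 (hx (interior_subset hw))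
  have hconv : ConvexOn ℝ (Set.Icc (-R) R) f := by
    refine MonotoneOn.convexOn_of_deriv (convex_Icc _ _)
      (fun w _ => (hf' w).continuousAt.continuousWithinAt)
      (fun w _ => (hf' w).differentiableAt.differentiableWithinAt) ?_
    rw [funext fun w => (hf' w).deriv]
    exact hmono.mono interior_subset
  have key : f v + (hazard ν v - m * v) * (u - v) ≤ f u := by
    rcases lt_trichotomy u v with h | h | h
    · have := hconv.slope_le_of_hasDerivAt (abs_le.1 hu) (abs_le.1 hv) h (hf' v)
      rw [slope_def_field, div_le_iff₀ (sub_pos.2 h)] at this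
      linarith
    · simp [h]
    · have := hconv.le_slope_of_hasDerivAt (abs_le.1 hv) (abs_le.1 hu) h (hf' v)
      rw [slope_def_field, le_div_iff₀ (sub_pos.2 h)] at this
      linarith
  simp only [hf] at key
  nlinarith

/-- `-log F` lies above its tangents. -/
theorem neg_log_cdf_ge (hν : NoiseAssumptions ν) (u v : ℝ) :
    -Real.log (noiseCDF ν v) - noiseDensity ν v / noiseCDF ν v * (u - v) ≤
      -Real.log (noiseCDF ν u) := by
  have hd := (hν.hasDerivAt_cdf v).log (hν.cdf_pos v).ne'
  have hconc := hν.logConcave_cdf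
  rcases lt_trichotomy u v with h | h | h
  · have := hconc.le_slope_of_hasDerivAt trivial trivial h hd
    rw [slope_def_field, le_div_iff₀ (sub_pos.2 h)] at this
    linarith
  · simp [h]
  · have := hconc.slope_le_of_hasDerivAt trivial trivial h hd
    rw [slope_def_field, div_le_iff₀ (sub_pos.2 h)] at this
    linarith

end NoiseAssumptions

/-! # Linear algebra -/

/-- The Euclidean norm of a vector. -/
def euclNorm {ι : Type*} [Fintype ι] (v : ι → ℝ) : ℝ := ‖WithLp.toLp 2 v‖

section EuclNorm

variable {ι : Type*} [Fintype ι] (v w : ι → ℝ)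

theorem euclNorm_nonneg : 0 ≤ euclNorm v := norm_nonneg _

theorem euclNorm_sq : euclNorm v ^ 2 = ∑ i, v i ^ 2 := by
  rw [euclNorm, EuclideanSpace.norm_sq_eq]
  simp

theorem dotProduct_self_eq_euclNorm_sq : v ⬝ᵥ v = euclNorm v ^ 2 := by
  rw [euclNorm_sq, dotProduct]
  exact Finset.sum_congr rfl fun i _ => (sq (v i)).symm

theorem abs_dotProduct_le : |v ⬝ᵥ w| ≤ euclNorm v * euclNorm w := by
  have h := abs_real_inner_le_norm (WithLp.toLp 2 w) (WithLp.toLp 2 v)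
  rw [EuclideanSpace.inner_toLp_toLp] at h
  simpa [euclNorm, mul_comm] using h

theorem euclNorm_sub_le : euclNorm (v - w) ≤ euclNorm v + euclNorm w := norm_sub_le _ _

theorem euclNorm_smul (c : ℝ) : euclNorm (c • v) = |c| * euclNorm v := by
  rw [euclNorm, WithLp.toLp_smul, norm_smul, Real.norm_eq_abs, euclNorm]

theorem abs_apply_le_euclNorm (i : ι) : |v i| ≤ euclNorm v := by
  rw [← abs_of_nonneg (euclNorm_nonneg v), ← sq_le_sq, euclNorm_sq]
  exact Finset.single_le_sum (f := fun i => v i ^ 2) (fun i _ => sq_nonneg _) (Finset.mem_univ i)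

theorem euclNorm_le_sum_abs : euclNorm v ≤ ∑ i, |v i| := by
  refine (sq_le_sq₀ (euclNorm_nonneg v) (Finset.sum_nonneg fun i _ => abs_nonneg _)).1 ?_
  rw [euclNorm_sq]
  simpa only [sq_abs] using
    Finset.sum_sq_le_sq_sum_of_nonneg (s := Finset.univ) fun i _ => abs_nonneg (v i)

/-- Cauchy–Schwarz over index pairs: a quadratic form is controlled by the Frobenius norm, whose
square is a sum of entries and so has a computable expectation. -/
theorem sq_sum_mul_mul_le (E : ι → ι → ℝ) :
    (∑ j, ∑ l, v j * v l * E j l) ^ 2 ≤ (euclNorm v ^ 2) ^ 2 * ∑ j, ∑ l, E j l ^ 2 := by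
  have h := Finset.sum_mul_sq_le_sq_mul_sq (Finset.univ : Finset (ι × ι))
    (fun q => v q.1 * v q.2) (fun q => E q.1 q.2)
  simp only [Fintype.sum_prod_type] at h
  refine h.trans_eq ?_
  congr 1
  rw [euclNorm_sq, sq (∑ i, v i ^ 2), Finset.sum_mul_sum]
  simp only [mul_pow]

end EuclNorm

/-- A lower bound for the spectrum of a Hermitian matrix bounds its quadratic form from below. -/
theorem _root_.Matrix.IsHermitian.mul_dotProduct_le {ι : Type*} [Fintype ι] [DecidableEq ι]
    {M : Matrix ι ι ℝ} (hM : M.IsHermitian) {c : ℝ} (hc : ∀ l ∈ spectrum ℝ M, c ≤ l) (v : ι → ℝ) :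
    c * (v ⬝ᵥ v) ≤ v ⬝ᵥ M.mulVec v := by
  -- Subtracting `c` times the identity shifts the spectrum by `-c`, which makes the matrix positive
  -- semidefinite.
  have hps : (M - algebraMap ℝ (Matrix ι ι ℝ) c).PosSemidef := by
    rw [Matrix.posSemidef_iff_isHermitian_and_spectrum_nonneg]
    refine ⟨hM.sub ?_, ?_⟩
    · rw [Matrix.algebraMap_eq_diagonal]
      exact Matrix.isHermitian_diagonal _
    · rw [← spectrum.sub_singleton_eq]
      rintro x ⟨l, hl, y, rfl, rfl⟩
      exact sub_nonneg.2 (hc l hl)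
  have h := hps.dotProduct_mulVec_nonneg v
  rw [Matrix.sub_mulVec, dotProduct_sub, star_trivial, Algebra.algebraMap_eq_smul_one,
    Matrix.smul_mulVec, Matrix.one_mulVec, dotProduct_smul, smul_eq_mul] at h
  linarith

/-- For `w = A⁻¹ v` one has `c ‖w‖² ≤ wᵀ A w = wᵀ v ≤ ‖w‖ ‖v‖`. This bounds the manipulation
direction `A⁻¹ β₀`. -/
theorem _root_.Matrix.PosDef.euclNorm_inv_mulVec_le {ι : Type*} [Fintype ι] [DecidableEq ι]
    {A : Matrix ι ι ℝ} (hA : A.PosDef) {c : ℝ} (hc0 : 0 < c) (hc : ∀ l ∈ spectrum ℝ A, c ≤ l)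
    (v : ι → ℝ) : euclNorm (A⁻¹.mulVec v) ≤ euclNorm v / c := by
  set w := A⁻¹.mulVec v with hw
  have hAw : A.mulVec w = v := by
    rw [hw, Matrix.mulVec_mulVec, Matrix.mul_nonsing_inv _ ((Matrix.isUnit_iff_isUnit_det A).1 hA.isUnit), Matrix.one_mulVec]
  have h1 := hA.1.mul_dotProduct_le hc w
  rw [hAw, dotProduct_self_eq_euclNorm_sq] at h1
  have h2 := (le_abs_self _).trans (abs_dotProduct_le w v)
  rw [le_div_iff₀ hc0]
  rcases (euclNorm_nonneg w).eq_or_lt with h | h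
  · rw [← h, zero_mul]; exact euclNorm_nonneg v
  · nlinarith

section Aug

variable {d : ℕ} (θ θ' : Fin (d + 1) → ℝ) (x : Fin d → ℝ)

theorem score_eq : score θ x = betaPart θ ⬝ᵥ x + θ (Fin.last d) := by
  simp [score, aug, betaPart, dotProduct, Fin.sum_univ_castSucc]

theorem score_sub_score : score θ x - score θ' x = (θ - θ') ⬝ᵥ aug x := by
  rw [score, score, sub_dotProduct]

theorem score_sub_apply (x' : Fin d → ℝ) : score θ (x - x') = score θ x - betaPart θ ⬝ᵥ x' := by
  rw [score_eq, score_eq, dotProduct_sub]; ring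

theorem betaPart_sub : betaPart (θ - θ') = betaPart θ - betaPart θ' := rfl

theorem euclNorm_betaPart_le : euclNorm (betaPart θ) ≤ euclNorm θ := by
  refine (sq_le_sq₀ (euclNorm_nonneg _) (euclNorm_nonneg _)).1 ?_
  rw [euclNorm_sq, euclNorm_sq, Fin.sum_univ_castSucc]
  exact le_add_of_nonneg_right (sq_nonneg _)

theorem euclNorm_aug_sub_le (x' : Fin d → ℝ) :
    euclNorm (aug (x - x')) ≤ euclNorm (aug x) + euclNorm x' := by
  have h : aug (x - x') = aug x - Fin.snoc (α := fun _ => ℝ) x' (0 : ℝ) := by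
    funext i
    refine Fin.lastCases ?_ (fun i => ?_) i <;> simp [aug]
  have h' : euclNorm (Fin.snoc (α := fun _ => ℝ) x' (0 : ℝ)) = euclNorm x' := by
    refine (sq_eq_sq₀ (euclNorm_nonneg _) (euclNorm_nonneg _)).1 ?_
    rw [euclNorm_sq, euclNorm_sq, Fin.sum_univ_castSucc]
    simp
  rw [h, ← h']
  exact euclNorm_sub_le _ _

theorem abs_score_le : |score θ x| ≤ euclNorm θ * euclNorm (aug x) := abs_dotProduct_le _ _

theorem abs_score_sub_score_le :
    |score θ x - score θ' x| ≤ euclNorm (θ - θ') * euclNorm (aug x) := by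
  rw [score_sub_score]; exact abs_dotProduct_le _ _

variable {θ θ'} {W : ℝ}

theorem euclNorm_le_of_mem_paramSet (h : θ ∈ paramSet d W) : euclNorm θ ≤ W :=
  (euclNorm_le_sum_abs θ).trans h

theorem euclNorm_sub_le_of_mem_paramSet (h : θ ∈ paramSet d W) (h' : θ' ∈ paramSet d W) :
    euclNorm (θ - θ') ≤ 2 * W := by
  have := euclNorm_sub_le θ θ'
  linarith [euclNorm_le_of_mem_paramSet h, euclNorm_le_of_mem_paramSet h']

theorem abs_score_le_of_mem_paramSet (h : θ ∈ paramSet d W) {Wx : ℝ} (hx : euclNorm (aug x) ≤ Wx) :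
    |score θ x| ≤ W * Wx :=
  (abs_score_le θ x).trans (mul_le_mul (euclNorm_le_of_mem_paramSet h) hx (euclNorm_nonneg _)
    ((euclNorm_nonneg _).trans (euclNorm_le_of_mem_paramSet h)))

end Aug

/-! # The error of the maximum likelihood estimator -/

/-- The derivative, with respect to the argument `u = p - θᵀx` at `u`, of the negative
log-likelihood of an observation with noise `z`. -/
def residual (ν : Measure ℝ) (u z : ℝ) : ℝ :=
  if u ≤ z then hazard ν u else -(noiseDensity ν u / noiseCDF ν u)

/-- `‖θ - θ₀‖² ≤ 2 / (κ m)² ‖G‖² + 8 W² / κ² ‖E‖²` for a maximizer `θ` of the log-likelihood,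
where `G` is the gradient at `θ₀` and `E` the deviation of the empirical second moment matrix,
restricted to the observations with noise at least `b`, from a matrix `M ≥ κ`. -/
theorem sq_euclNorm_mle_sub_le {ν : Measure ℝ} (hν : NoiseAssumptions ν) {d n : ℕ} (hn : 0 < n)
    {W Wx B m κ b : ℝ} (hb : b = B + W * Wx) (hm : 0 < m) (hκ : 0 < κ) (hB : 0 < B)
    (hcurv : ∀ u v, |u| ≤ b → |v| ≤ b →
      -Real.log (1 - noiseCDF ν v) + hazard ν v * (u - v) + m * (u - v) ^ 2 ≤
        -Real.log (1 - noiseCDF ν u))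
    {θ θ₀ : Fin (d + 1) → ℝ} (hθ : θ ∈ paramSet d W) (hθ₀ : θ₀ ∈ paramSet d W)
    {data : Fin n → Obs d} {z : Fin n → ℝ} (hx : ∀ i, euclNorm (aug (data i).1) ≤ Wx)
    (hp : ∀ i, (data i).2.1 ∈ Set.Ioo 0 B)
    (hy : ∀ i, (data i).2.2 = true ↔ (data i).2.1 ≤ score θ₀ (data i).1 + z i)
    (hmax : logLik ν data θ₀ ≤ logLik ν data θ)
    {M : Fin (d + 1) → Fin (d + 1) → ℝ}
    (hM : ∀ v : Fin (d + 1) → ℝ, κ * euclNorm v ^ 2 ≤ ∑ j, ∑ l, v j * v l * M j l) :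
    euclNorm (θ - θ₀) ^ 2 ≤
      2 / (κ * m) ^ 2 * ∑ j, ((1 / (n : ℝ)) *
        ∑ i, residual ν ((data i).2.1 - score θ₀ (data i).1) (z i) * aug (data i).1 j) ^ 2 +
      8 * W ^ 2 / κ ^ 2 * ∑ j, ∑ l, (M j l - (1 / (n : ℝ)) *
        ∑ i, (Set.Ici b).indicator 1 (z i) * (aug (data i).1 j * aug (data i).1 l)) ^ 2 := by
  set Δ := θ - θ₀ with hΔ
  set u : Fin n → ℝ := fun i => (data i).2.1 - score θ₀ (data i).1 with hu
  set ξ : Fin n → ℝ := fun i => residual ν (u i) (z i) with hξ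
  set s : Fin n → ℝ := fun i => Δ ⬝ᵥ aug (data i).1 with hs
  set e : Fin n → ℝ := fun i => (Set.Ici b).indicator 1 (z i) with he
  set G : Fin (d + 1) → ℝ := fun j => (1 / (n : ℝ)) * ∑ i, ξ i * aug (data i).1 j with hG
  set N : Fin (d + 1) → Fin (d + 1) → ℝ := fun j l =>
    (1 / (n : ℝ)) * ∑ i, e i * (aug (data i).1 j * aug (data i).1 l) with hN
  have hn' : (0 : ℝ) < n := Nat.cast_pos.2 hn
  have hub : ∀ θ' ∈ paramSet d W, ∀ i, |(data i).2.1 - score θ' (data i).1| ≤ b := by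
    intro θ' h' i
    have h1 := abs_score_le_of_mem_paramSet (data i).1 h' (hx i)
    have h2 := hp i
    rw [abs_le] at h1 ⊢
    constructor <;> linarith [h2.1, h2.2]
  -- A sale contributes the quadratic gain `m s²`, at least `m e s²`; without a sale there is only
  -- convexity, which is enough because then `e = 0`.
  have hterm : ∀ i, (if (data i).2.2 = true
        then Real.log (1 - noiseCDF ν ((data i).2.1 - score θ (data i).1))
        else Real.log (noiseCDF ν ((data i).2.1 - score θ (data i).1))) ≤
      (if (data i).2.2 = true
        then Real.log (1 - noiseCDF ν (u i)) else Real.log (noiseCDF ν (u i))) +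
        (ξ i * s i - m * (e i * s i ^ 2)) := by
    intro i
    have hd : (data i).2.1 - score θ (data i).1 - u i = -s i := by
      rw [hs, hu, hΔ]; simp only; rw [← score_sub_score]; ring
    have hyi : (data i).2.2 = true ↔ u i ≤ z i := by
      rw [hy i, hu]; simp only; constructor <;> intro h <;> linarith
    have hei : e i ≤ 1 := by
      simp only [he, Set.indicator]; split_ifs <;> simp
    by_cases h : u i ≤ z i
    · have h1 := hcurv _ _ (hub θ hθ i) (hub θ₀ hθ₀ i)
      rw [if_pos (hyi.2 h), if_pos (hyi.2 h)]
      have hxi : ξ i = hazard ν (u i) := if_pos h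
      rw [hxi]
      change -Real.log (1 - noiseCDF ν (u i)) + hazard ν (u i) *
        ((data i).2.1 - score θ (data i).1 - u i) + m *
        ((data i).2.1 - score θ (data i).1 - u i) ^ 2 ≤ _ at h1
      rw [hd] at h1
      have h2 : m * (e i * s i ^ 2) ≤ m * (1 * s i ^ 2) := by gcongr
      nlinarith
    · have h1 := hν.neg_log_cdf_ge ((data i).2.1 - score θ (data i).1) (u i)
      rw [if_neg (mt hyi.1 h), if_neg (mt hyi.1 h)]
      have hxi : ξ i = -(noiseDensity ν (u i) / noiseCDF ν (u i)) := if_neg h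
      -- Noise of at least `b` exceeds every possible `u i`, so it would have produced a sale.
      have hei : e i = 0 := by
        refine Set.indicator_of_notMem (fun hz => h ?_) _
        exact ((le_abs_self _).trans (hub θ₀ hθ₀ i)).trans hz
      rw [hxi, hei]
      rw [hd] at h1
      linarith
  -- Maximality of `θ` is used only against `θ₀`: the likelihood gain is nonnegative, so the linear
  -- term dominates the curvature term.
  have hsum : m * ∑ i, e i * s i ^ 2 ≤ ∑ i, ξ i * s i := by
    have h1 := le_of_mul_le_mul_left hmax (by positivity)
    have h2 := h1.trans (Finset.sum_le_sum fun i _ => hterm i)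
    rw [Finset.sum_add_distrib, Finset.sum_sub_distrib, ← Finset.mul_sum] at h2
    linarith
  have hquad : ∑ j, ∑ l, Δ j * Δ l * N j l = (1 / (n : ℝ)) * ∑ i, e i * s i ^ 2 := by
    have h : ∀ i, e i * s i ^ 2 =
        ∑ j, ∑ l, Δ j * Δ l * (e i * (aug (data i).1 j * aug (data i).1 l)) := fun i => by
      simp only [hs, dotProduct, sq]
      rw [Finset.sum_mul_sum]
      simp only [Finset.mul_sum]
      exact Finset.sum_congr rfl fun j _ => Finset.sum_congr rfl fun l _ => by ring
    simp only [h, hN, Finset.mul_sum]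
    rw [Finset.sum_comm (s := (Finset.univ : Finset (Fin n)))]
    refine Finset.sum_congr rfl fun j _ => ?_
    rw [Finset.sum_comm (s := (Finset.univ : Finset (Fin n)))]
    exact Finset.sum_congr rfl fun l _ => Finset.sum_congr rfl fun i _ => by ring
  have hlin : Δ ⬝ᵥ G = (1 / (n : ℝ)) * ∑ i, ξ i * s i := by
    simp only [hG, hs, dotProduct, Finset.mul_sum]
    rw [Finset.sum_comm]
    exact Finset.sum_congr rfl fun i _ => Finset.sum_congr rfl fun j _ => by ring
  have h1 : m * ∑ j, ∑ l, Δ j * Δ l * N j l ≤ euclNorm Δ * euclNorm G := by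
    refine le_trans ?_ ((le_abs_self _).trans (abs_dotProduct_le Δ G))
    rw [hquad, hlin, mul_left_comm]
    gcongr
  set q := √(∑ j, ∑ l, (M j l - N j l) ^ 2) with hq
  have hq0 : 0 ≤ ∑ j, ∑ l, (M j l - N j l) ^ 2 := by positivity
  have h2 : ∑ j, ∑ l, Δ j * Δ l * (M j l - N j l) ≤ euclNorm Δ ^ 2 * q := by
    refine (le_abs_self _).trans (abs_le_of_sq_le_sq ?_ (by positivity))
    rw [mul_pow, hq, Real.sq_sqrt hq0]
    exact sq_sum_mul_mul_le Δ fun j l => M j l - N j l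
  have h3 := hM Δ
  have h4 : ∑ j, ∑ l, Δ j * Δ l * M j l =
      ∑ j, ∑ l, Δ j * Δ l * N j l + ∑ j, ∑ l, Δ j * Δ l * (M j l - N j l) := by
    simp only [← Finset.sum_add_distrib]
    exact Finset.sum_congr rfl fun j _ => Finset.sum_congr rfl fun l _ => by ring
  have hΔW : euclNorm Δ ≤ 2 * W := euclNorm_sub_le_of_mem_paramSet hθ hθ₀
  have hΔ0 := euclNorm_nonneg Δ
  have hG0 := euclNorm_nonneg G
  have hqn : 0 ≤ q := Real.sqrt_nonneg _
  -- One factor `‖Δ‖` is cancelled. In the deviation term a second one is replaced by the diameter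
  -- bound `2 W`, so no lower bound on the random matrix is needed.
  have h5 : κ * m * euclNorm Δ ≤ euclNorm G + 2 * W * m * q := by
    rcases hΔ0.eq_or_lt with h | h
    · rw [← h, mul_zero]
      have : 0 ≤ W := by linarith
      positivity
    · refine le_of_mul_le_mul_left ?_ h
      have e1 : m * (κ * euclNorm Δ ^ 2) ≤
          euclNorm Δ * euclNorm G + m * (euclNorm Δ ^ 2 * q) := by
        rw [h4] at h3
        nlinarith [mul_le_mul_of_nonneg_left h3 hm.le, mul_le_mul_of_nonneg_left h2 hm.le]
      have e2 : euclNorm Δ * (m * euclNorm Δ * q) ≤ euclNorm Δ * (m * (2 * W) * q) := by gcongr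
      nlinarith
  have h6 : (κ * m * euclNorm Δ) ^ 2 ≤ 2 * (euclNorm G ^ 2) + 8 * W ^ 2 * m ^ 2 * q ^ 2 := by
    have e1 : (κ * m * euclNorm Δ) ^ 2 ≤ (euclNorm G + 2 * W * m * q) ^ 2 := by
      gcongr
    nlinarith [sq_nonneg (euclNorm G - 2 * W * m * q)]
  rw [euclNorm_sq G, hq, Real.sq_sqrt hq0] at h6
  have h7 : euclNorm Δ ^ 2 = (κ * m * euclNorm Δ) ^ 2 / (κ * m) ^ 2 := by
    field_simp
  rw [h7, div_le_iff₀ (by positivity)]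
  refine h6.trans_eq ?_
  change _ = (2 / (κ * m) ^ 2 * ∑ j, G j ^ 2 +
    8 * W ^ 2 / κ ^ 2 * ∑ j, ∑ l, (M j l - N j l) ^ 2) * (κ * m) ^ 2
  field_simp

/-! # Probability -/

section Independence

variable {Ω α β γ δ : Type*} [MeasurableSpace Ω] [MeasurableSpace α] [MeasurableSpace β]
  [MeasurableSpace γ] [MeasurableSpace δ] {μ : Measure Ω} [IsProbabilityMeasure μ]

/-- Both hypotheses together say that the joint law is a threefold product, and product measures are
associative. -/
theorem _root_.ProbabilityTheory.IndepFun.prodMk_right_of_prodMk_left {X : Ω → α} {Y : Ω → β}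
    {Z : Ω → γ} (hX : Measurable X) (hY : Measurable Y) (hZ : Measurable Z)
    (h : IndepFun X Y μ) (h' : IndepFun (fun ω => (X ω, Y ω)) Z μ) :
    IndepFun X (fun ω => (Y ω, Z ω)) μ := by
  have hYZ : IndepFun Y Z μ := h'.comp measurable_snd measurable_id
  rw [indepFun_iff_map_prod_eq_prod_map_map hX.aemeasurable (hY.prodMk hZ).aemeasurable,
    hYZ.map_prod_eq_prod_map_map hY.aemeasurable hZ.aemeasurable,
    ← Measure.prodAssoc_prod, ← h.map_prod_eq_prod_map_map hX.aemeasurable hY.aemeasurable,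
    ← h'.map_prod_eq_prod_map_map (hX.prodMk hY).aemeasurable hZ.aemeasurable,
    Measure.map_map (by fun_prop) (by fun_prop)]
  rfl

/-- Regroups four independent blocks from "by kind of variable" to "by period", the form needed to
compare observations of two periods. -/
theorem _root_.ProbabilityTheory.IndepFun.prodMk_prodMk_comm {X : Ω → α} {X' : Ω → β}
    {Y : Ω → γ} {Y' : Ω → δ} (hX : Measurable X) (hX' : Measurable X') (hY : Measurable Y)
    (hY' : Measurable Y') (h : IndepFun X X' μ) (h' : IndepFun Y Y' μ)
    (hh : IndepFun (fun ω => (X ω, X' ω)) (fun ω => (Y ω, Y' ω)) μ) :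
    IndepFun (fun ω => (X ω, Y ω)) (fun ω => (X' ω, Y' ω)) μ := by
  have h1 : IndepFun X (fun ω => (X' ω, Y' ω)) μ :=
    h.prodMk_right_of_prodMk_left hX hX' hY' (hh.comp measurable_id measurable_snd)
  have h2 : IndepFun Y (fun ω => (Y' ω, (X ω, X' ω))) μ :=
    h'.prodMk_right_of_prodMk_left hY hY' (hX.prodMk hX') hh.symm
  have h3 : IndepFun (fun ω => ((X' ω, Y' ω), X ω)) Y μ :=
    (h2.comp measurable_id (ψ := fun q : δ × (α × β) => ((q.2.2, q.1), q.2.1))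
      (by fun_prop)).symm
  exact (h1.symm.prodMk_right_of_prodMk_left (hX'.prodMk hY') hX hY h3).symm

/-- Freezing an independent variable. -/
theorem _root_.ProbabilityTheory.IndepFun.integral_comp_prodMk {Y : Ω → α} {Z : Ω → β}
    (hY : Measurable Y) (hZ : Measurable Z) (h : IndepFun Y Z μ) {G : α × β → ℝ}
    (hG : Measurable G) (hint : Integrable (fun ω => G (Y ω, Z ω)) μ) :
    ∫ ω, G (Y ω, Z ω) ∂μ = ∫ ω, ∫ z, G (Y ω, z) ∂(μ.map Z) ∂μ := by
  have := Measure.isProbabilityMeasure_map (μ := μ) hZ.aemeasurable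
  have := Measure.isProbabilityMeasure_map (μ := μ) hY.aemeasurable
  have hmap := h.map_prod_eq_prod_map_map hY.aemeasurable hZ.aemeasurable
  have hYZ : Measurable fun ω => (Y ω, Z ω) := hY.prodMk hZ
  have hint' : Integrable G ((μ.map Y).prod (μ.map Z)) := by
    rw [← hmap, integrable_map_measure hG.aestronglyMeasurable hYZ.aemeasurable]
    exact hint
  rw [← integral_map (f := G) hYZ.aemeasurable hG.aestronglyMeasurable, hmap,
    integral_prod _ hint', integral_map hY.aemeasurable]
  exact hint'.integral_prod_left.aestronglyMeasurable

theorem _root_.MeasureTheory.Integrable.of_measurable_of_ae_abs_le {X : Ω → ℝ} (hX : Measurable X)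
    {K : ℝ} (hK : ∀ᵐ ω ∂μ, |X ω| ≤ K) : Integrable X μ :=
  Integrable.of_bound hX.aestronglyMeasurable K hK

theorem _root_.MeasureTheory.integral_le_of_ae_le {X : Ω → ℝ} (hX : Integrable X μ)
    {K : ℝ} (hK : ∀ᵐ ω ∂μ, X ω ≤ K) : ∫ ω, X ω ∂μ ≤ K := by
  have := integral_mono_ae hX (integrable_const K) hK
  simpa using this

/-- The mean squared error of the average of bounded pairwise independent variables. -/
theorem integral_sq_sub_average_le {n : ℕ} (hn : 0 < n) {X : Fin n → Ω → ℝ} {K c : ℝ}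
    (hX : ∀ i, Measurable (X i)) (hK : ∀ i, ∀ᵐ ω ∂μ, |X i ω| ≤ K)
    (hmean : ∀ i, ∫ ω, X i ω ∂μ = c) (hind : Pairwise fun i j => IndepFun (X i) (X j) μ) :
    ∫ ω, (c - (1 / (n : ℝ)) * ∑ i, X i ω) ^ 2 ∂μ ≤ K ^ 2 / n := by
  have hn' : (0 : ℝ) < n := Nat.cast_pos.2 hn
  have hmem : ∀ i, MemLp (X i) 2 μ := fun i =>
    MemLp.of_bound (hX i).aestronglyMeasurable K (hK i)
  have hint : ∀ i, Integrable (X i) μ := fun i => (hmem i).integrable (by norm_num)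
  have hsum : Measurable (∑ i, X i) := by fun_prop
  have hE : ∫ ω, (∑ i, X i) ω ∂μ = n * c := by
    simp only [Finset.sum_apply]
    rw [integral_finsetSum _ fun i _ => hint i]
    simp [hmean]
  have hvar : variance (∑ i, X i) μ ≤ n * K ^ 2 := by
    -- Additivity of the variance needs pairwise independence only.
    rw [IndepFun.variance_sum (fun i _ => hmem i) fun i _ j _ hij => hind hij]
    calc ∑ i, variance (X i) μ ≤ ∑ _i : Fin n, K ^ 2 := Finset.sum_le_sum fun i _ => by
          refine (variance_le_expectation_sq (hX i).aestronglyMeasurable).trans ?_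
          refine integral_le_of_ae_le (hmem i).integrable_sq ?_
          filter_upwards [hK i] with ω hω
          rw [← sq_abs]
          gcongr
      _ = n * K ^ 2 := by simp
  rw [variance_eq_integral hsum.aemeasurable, hE] at hvar
  have e : ∀ ω, (c - (1 / (n : ℝ)) * ∑ i, X i ω) ^ 2 =
      (1 / (n : ℝ)) ^ 2 * ((∑ i, X i) ω - n * c) ^ 2 := fun ω => by
    rw [Finset.sum_apply]; field_simp; ring
  simp only [e]
  rw [integral_const_mul]
  calc _ ≤ (1 / (n : ℝ)) ^ 2 * (n * K ^ 2) := by gcongr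
    _ = K ^ 2 / n := by field_simp

theorem integrable_sq_sub_average {n : ℕ} {X : Fin n → Ω → ℝ} {K : ℝ} (c : ℝ)
    (hX : ∀ i, Measurable (X i)) (hK : ∀ i, ∀ᵐ ω ∂μ, |X i ω| ≤ K) :
    Integrable (fun ω => (c - (1 / (n : ℝ)) * ∑ i, X i ω) ^ 2) μ := by
  have h : ∀ i ∈ Finset.univ, MemLp (X i) 2 μ := fun i _ =>
    MemLp.of_bound (hX i).aestronglyMeasurable K (hK i)
  exact ((memLp_const c).sub ((memLp_finsetSum _ h).const_mul (1 / (n : ℝ)))).integrable_sq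

end Independence

/-! ### Bounds and means of the likelihood residual and of the revenue. -/

namespace NoiseAssumptions

variable {ν : Measure ℝ}

theorem measurable_residual (hν : NoiseAssumptions ν) :
    Measurable fun q : ℝ × ℝ => residual ν q.1 q.2 := by
  have h1 := hν.continuous_cdf.measurable
  have h2 := hν.continuous_density.measurable
  unfold residual hazard
  exact Measurable.ite (measurableSet_le (by fun_prop) (by fun_prop)) (by fun_prop) (by fun_prop)

theorem exists_abs_residual_le (hν : NoiseAssumptions ν) (R : ℝ) :
    ∃ C, 0 < C ∧ ∀ u z, |u| ≤ R → |residual ν u z| ≤ C := by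
  obtain ⟨C₁, hC₁, h₁⟩ := (continuous_iff_continuousAt.2
    fun v => (hν.hasDerivAt_hazard v).continuousAt).exists_abs_le_of_abs_le R
  obtain ⟨C₂, hC₂, h₂⟩ := (hν.continuous_density.div₀ hν.continuous_cdf
    fun v => (hν.cdf_pos v).ne').exists_abs_le_of_abs_le R
  refine ⟨max C₁ C₂, lt_max_of_lt_left hC₁, fun u z hu => ?_⟩
  rw [residual]
  split_ifs
  · exact (h₁ u hu).trans (le_max_left _ _)
  · rw [abs_neg]; exact (h₂ u hu).trans (le_max_right _ _)

variable [IsProbabilityMeasure ν]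

theorem measureReal_Ici (hν : NoiseAssumptions ν) (u : ℝ) :
    ν.real (Set.Ici u) = 1 - noiseCDF ν u := by
  have hcont : Continuous (cdf ν) := hν.continuous_cdf
  have h := (cdf ν).measure_Ici (tendsto_cdf_atTop ν) u
  rw [measure_cdf, hcont.continuousAt.continuousWithinAt.leftLim_eq] at h
  rw [Measure.real, h, ENNReal.toReal_ofReal (sub_nonneg.2 (cdf_le_one ν u))]
  rfl

theorem measureReal_Iio (hν : NoiseAssumptions ν) (u : ℝ) :
    ν.real (Set.Iio u) = noiseCDF ν u := by
  rw [← Set.compl_Ici, probReal_compl_eq_one_sub measurableSet_Ici, hν.measureReal_Ici]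
  ring

theorem integral_revenue (hν : NoiseAssumptions ν) (p q : ℝ) :
    ∫ z, revenue p (q + z) ∂ν = p * (1 - noiseCDF ν (p - q)) := by
  have e : ∀ z, revenue p (q + z) = (Set.Ici (p - q)).indicator (fun _ => p) z := fun z => by
    simp [revenue, Set.indicator, add_comm]
  simp only [e]
  rw [integral_indicator_const _ measurableSet_Ici, hν.measureReal_Ici, smul_eq_mul, mul_comm]

/-- A sale has probability `1 - F(u)`, so the mean is `h(u) (1 - F(u)) - (f(u) / F(u)) F(u) = f(u) -
f(u)`. The log-likelihood gradient at the true parameter is therefore centred. -/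
theorem integral_residual (hν : NoiseAssumptions ν) (u : ℝ) : ∫ z, residual ν u z ∂ν = 0 := by
  have e : ∀ z, residual ν u z = (Set.Ici u).indicator (fun _ => hazard ν u) z +
      (Set.Iio u).indicator (fun _ => -(noiseDensity ν u / noiseCDF ν u)) z := fun z => by
    rw [residual]
    split_ifs with h
    · simp [Set.indicator, h]
    · simp [Set.indicator, h]
  simp only [e]
  rw [integral_add ((integrable_const _).indicator measurableSet_Ici)
      ((integrable_const _).indicator measurableSet_Iio),
    integral_indicator_const _ measurableSet_Ici, integral_indicator_const _ measurableSet_Iio,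
    hν.measureReal_Ici, hν.measureReal_Iio, hazard]
  have h1 := (hν.cdf_pos u).ne'
  have h2 := (sub_pos.2 (hν.cdf_lt_one u)).ne'
  simp only [smul_eq_mul]
  field_simp
  ring

end NoiseAssumptions

/-! # Paths as measurable objects -/

section PathMeasurable

variable {d : ℕ}

/-- The components of a path. -/
def Path.toProd (s : Path d) :
    ((ℕ → ℕ) × (ℕ → Fin d → ℝ) × (ℕ → Fin d → ℝ)) × (ℕ → ℝ) × (ℕ → ℝ) :=
  ((s.ident, s.feat, s.manip), s.noise, s.unif)

/-- With this σ-algebra a map into paths is measurable as soon as its five components are, so that a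
whole path can serve as one random variable. -/
instance : MeasurableSpace (Path d) := MeasurableSpace.comap Path.toProd inferInstance

theorem Path.measurable_toProd : Measurable (Path.toProd (d := d)) := comap_measurable _

@[fun_prop]
theorem Path.measurable_ident : Measurable (Path.ident (d := d)) :=
  measurable_fst.comp (measurable_fst.comp Path.measurable_toProd)

@[fun_prop]
theorem Path.measurable_feat : Measurable (Path.feat (d := d)) :=
  measurable_fst.comp (measurable_snd.comp (measurable_fst.comp Path.measurable_toProd))

@[fun_prop]
theorem Path.measurable_manip : Measurable (Path.manip (d := d)) :=
  measurable_snd.comp (measurable_snd.comp (measurable_fst.comp Path.measurable_toProd))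

@[fun_prop]
theorem Path.measurable_noise : Measurable (Path.noise (d := d)) :=
  measurable_fst.comp (measurable_snd.comp Path.measurable_toProd)

@[fun_prop]
theorem Path.measurable_unif : Measurable (Path.unif (d := d)) :=
  measurable_snd.comp (measurable_snd.comp Path.measurable_toProd)

theorem Path.measurable_ident_apply (t : ℕ) : Measurable fun s : Path d => s.ident t :=
  (measurable_pi_apply t).comp Path.measurable_ident

theorem Path.measurable_feat_apply (t : ℕ) : Measurable fun s : Path d => s.feat t :=
  (measurable_pi_apply t).comp Path.measurable_feat

theorem Path.measurable_manip_apply (t : ℕ) : Measurable fun s : Path d => s.manip t :=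
  (measurable_pi_apply t).comp Path.measurable_manip

theorem Path.measurable_noise_apply (t : ℕ) : Measurable fun s : Path d => s.noise t :=
  (measurable_pi_apply t).comp Path.measurable_noise

theorem Path.measurable_unif_apply (t : ℕ) : Measurable fun s : Path d => s.unif t :=
  (measurable_pi_apply t).comp Path.measurable_unif

theorem Path.measurable_mk {α : Type*} [MeasurableSpace α] {e : α → ℕ → ℕ}
    {x y : α → ℕ → Fin d → ℝ} {z p : α → ℕ → ℝ} (he : Measurable e) (hx : Measurable x)
    (hy : Measurable y) (hz : Measurable z) (hp : Measurable p) :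
    Measurable fun a => (⟨e a, x a, y a, z a, p a⟩ : Path d) :=
  measurable_comap_iff.2 ((he.prodMk (hx.prodMk hy)).prodMk (hz.prodMk hp))

@[fun_prop]
theorem measurable_aug : Measurable (aug (d := d)) := by
  refine measurable_pi_lambda _ fun j => ?_
  refine Fin.lastCases ?_ (fun i => ?_) j
  · simp [aug]
  · simpa [aug] using measurable_pi_apply i

@[fun_prop]
theorem _root_.Measurable.score {α : Type*} [MeasurableSpace α] {θ : α → Fin (d + 1) → ℝ}
    {x : α → Fin d → ℝ} (hθ : Measurable θ) (hx : Measurable x) :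
    Measurable fun a => score (θ a) (x a) := by
  unfold StrategicPricing.score dotProduct
  fun_prop

@[fun_prop]
theorem measurable_euclNorm {ι : Type*} [Fintype ι] :
    Measurable (euclNorm : (ι → ℝ) → ℝ) := by
  unfold euclNorm
  exact (PiLp.continuous_toLp 2 _).norm.measurable

theorem measurable_valuation (θ₀ : Fin (d + 1) → ℝ) (t : ℕ) :
    Measurable fun s : Path d => valuation θ₀ s t :=
  (measurable_const.score (Path.measurable_feat_apply t)).add (Path.measurable_noise_apply t)

theorem measurable_thetaHat (l₀ : ℕ) (Ca : ℝ) {est : (n : ℕ) → (Fin n → Obs d) → (Fin (d + 1) → ℝ)}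
    (hest : ∀ n, Measurable (est n)) (θ₀ : Fin (d + 1) → ℝ) (k : ℕ) :
    Measurable fun s : Path d => thetaHat l₀ Ca est θ₀ s k := by
  refine (hest _).comp (measurable_pi_lambda _ fun i => ?_)
  refine (Path.measurable_feat_apply _).prodMk ((Path.measurable_unif_apply _).prodMk ?_)
  refine measurable_to_bool ?_
  simp only [Set.preimage, Set.mem_singleton_iff, decide_eq_true_eq]
  exact measurableSet_le (Path.measurable_unif_apply _) (measurable_valuation θ₀ _)

end PathMeasurable

/-! ### The second moment matrix. -/

section SecondMoment

variable {d : ℕ} {P : Measure (Fin d → ℝ)} {Wx lmin : ℝ}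

theorem integrable_aug_mul_aug [IsProbabilityMeasure P] (hP : ∀ᵐ x ∂P, euclNorm (aug x) ≤ Wx) (j l : Fin (d + 1)) :
    Integrable (fun x => aug x j * aug x l) P := by
  refine Integrable.of_measurable_of_ae_abs_le (K := Wx * Wx) (by fun_prop) ?_
  filter_upwards [hP] with x hx
  rw [abs_mul]
  exact mul_le_mul ((abs_apply_le_euclNorm _ _).trans hx) ((abs_apply_le_euclNorm _ _).trans hx)
    (abs_nonneg _) ((euclNorm_nonneg _).trans hx)

theorem mul_sq_euclNorm_le_secondMoment (hl : ∀ l ∈ spectrum ℝ (secondMoment P), lmin ≤ l)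
    (v : Fin (d + 1) → ℝ) :
    lmin * euclNorm v ^ 2 ≤ ∑ j, ∑ l, v j * v l * secondMoment P j l := by
  have hH : (secondMoment P).IsHermitian := by
    refine Matrix.IsHermitian.ext fun i j => ?_
    simp [secondMoment, mul_comm]
  have h := hH.mul_dotProduct_le hl v
  rw [dotProduct_self_eq_euclNorm_sq] at h
  refine h.trans_eq ?_
  simp only [dotProduct, Matrix.mulVec, Finset.mul_sum]
  exact Finset.sum_congr rfl fun j _ => Finset.sum_congr rfl fun l _ => by ring

/-- Bounded features and a lower bound for the second moments bound the dimension. -/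
theorem dim_mul_le [IsProbabilityMeasure P] (hP : ∀ᵐ x ∂P, euclNorm (aug x) ≤ Wx)
    (hl : ∀ l ∈ spectrum ℝ (secondMoment P), lmin ≤ l) : ((d : ℝ) + 1) * lmin ≤ Wx ^ 2 := by
  -- Basis vectors in the quadratic form bound each diagonal entry below; the trace is the mean of
  -- the squared feature norm.
  have h1 : ∀ j, lmin ≤ secondMoment P j j := fun j => by
    have := mul_sq_euclNorm_le_secondMoment hl (Pi.single j 1)
    rw [euclNorm_sq] at this
    simpa [Pi.single_apply] using this
  calc ((d : ℝ) + 1) * lmin = ∑ _j : Fin (d + 1), lmin := by simp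
    _ ≤ ∑ j, secondMoment P j j := Finset.sum_le_sum fun j _ => h1 j
    _ = ∫ x, ∑ j, aug x j * aug x j ∂P :=
      (integral_finsetSum _ fun j _ => integrable_aug_mul_aug hP j j).symm
    _ ≤ Wx ^ 2 := by
      refine integral_le_of_ae_le (integrable_finsetSum _ fun j _ =>
        integrable_aug_mul_aug hP j j) ?_
      filter_upwards [hP] with x hx
      simp only [← sq, ← euclNorm_sq]
      have := euclNorm_nonneg (aug x)
      gcongr

end SecondMoment

/-! ### Independence relations in the market. -/

namespace IsMarket

variable {Ω : Type*} [MeasurableSpace Ω] {μ : Measure Ω} {ν : Measure ℝ}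
  {B : ℝ} {l₀ : ℕ} {Ca : ℝ} {d : ℕ} {A : Matrix (Fin d) (Fin d) ℝ} {θ₀ : Fin (d + 1) → ℝ}
  {P : Measure (Fin d → ℝ)} {τ : ℝ} {S : Ω → Path d}

theorem measurable_path (H : IsMarket μ ν B l₀ Ca A θ₀ P τ S) : Measurable S :=
  Path.measurable_mk (measurable_pi_lambda _ H.measurable_ident)
    (measurable_pi_lambda _ H.measurable_feat) (measurable_pi_lambda _ H.measurable_manip)
    (measurable_pi_lambda _ H.measurable_noise) (measurable_pi_lambda _ H.measurable_unif)

theorem ae_feat (H : IsMarket μ ν B l₀ Ca A θ₀ P τ S) {p : (Fin d → ℝ) → Prop}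
    (hp : ∀ᵐ x ∂P, p x) (t : ℕ) : ∀ᵐ ω ∂μ, p ((S ω).feat t) :=
  ae_of_ae_map (H.measurable_feat t).aemeasurable (by rwa [H.feat_law t])

theorem ae_unif_mem (H : IsMarket μ ν B l₀ Ca A θ₀ P τ S) (t : ℕ) :
    ∀ᵐ ω ∂μ, (S ω).unif t ∈ Set.Ioo 0 B :=
  ae_of_ae_map (H.measurable_unif t).aemeasurable
    (by rw [H.unif_law t]; exact ae_cond_mem measurableSet_Ioo)

/-- The noise is independent of all other exogenous variables. -/
theorem indepFun_noise [IsProbabilityMeasure μ] (H : IsMarket μ ν B l₀ Ca A θ₀ P τ S) :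
    IndepFun (fun ω => (S ω).noise)
      (fun ω => ((S ω).unif, ((S ω).ident, (S ω).feat, (S ω).manip))) μ :=
  have hS := H.measurable_path
  H.noise_indep_unif.prodMk_right_of_prodMk_left (by fun_prop) (by fun_prop) (by fun_prop)
    H.arrivals_indep.symm

/-- The noise of period `t` is independent of the earlier noise and of all other exogenous
variables. -/
theorem indepFun_noise_apply [IsProbabilityMeasure μ] (H : IsMarket μ ν B l₀ Ca A θ₀ P τ S) (t : ℕ) :
    IndepFun (fun ω => (S ω).noise t)
      (fun ω => ((fun r : Finset.range t => (S ω).noise r),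
        ((S ω).unif, ((S ω).ident, (S ω).feat, (S ω).manip)))) μ := by
  have hS := H.measurable_path
  have h := H.noise_indep.indepFun_finset {t} (Finset.range t) (by simp) H.measurable_noise
  have h1 : IndepFun (fun ω => (S ω).noise t)
      (fun ω => fun r : Finset.range t => (S ω).noise r) μ :=
    h.comp (φ := fun f : ({t} : Finset ℕ) → ℝ => f ⟨t, Finset.mem_singleton_self t⟩)
      (measurable_pi_apply _) measurable_id
  refine h1.prodMk_right_of_prodMk_left (H.measurable_noise t)
    (measurable_pi_lambda _ fun r => H.measurable_noise r) (by fun_prop) ?_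
  exact H.indepFun_noise.comp
    (φ := fun z : ℕ → ℝ => (z t, fun r : Finset.range t => z r)) (by fun_prop) measurable_id

/-- The observations of distinct periods of an exploration phase are independent. -/
theorem pairwise_indepFun_obs [IsProbabilityMeasure μ] (H : IsMarket μ ν B l₀ Ca A θ₀ P τ S) {k : ℕ} (hk : 1 ≤ k) :
    Pairwise fun i j : Fin (exploreLen l₀ Ca k) => IndepFun
      (fun ω => ((S ω).feat (epLen l₀ k + i), (S ω).noise (epLen l₀ k + i),
        (S ω).unif (epLen l₀ k + i)))
      (fun ω => ((S ω).feat (epLen l₀ k + j), (S ω).noise (epLen l₀ k + j),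
        (S ω).unif (epLen l₀ k + j))) μ := by
  intro i j hij
  have hij' : epLen l₀ k + (i : ℕ) ≠ epLen l₀ k + j := fun h =>
    hij (Fin.ext (Nat.add_left_cancel h))
  generalize hs : epLen l₀ k + (i : ℕ) = s at *
  generalize ht : epLen l₀ k + (j : ℕ) = t at *
  have hfeat : IndepFun (fun ω => (S ω).feat s) (fun ω => (S ω).feat t) μ := by
    simpa only [hs, ht] using (H.feat_indep k hk).indepFun hij
  have hnu := H.noise_indep_unif.comp
    (φ := fun z : ℕ → ℝ => (z s, z t)) (ψ := fun p : ℕ → ℝ => (p s, p t))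
    (by fun_prop) (by fun_prop)
  have h1 := (H.noise_indep.indepFun hij').prodMk_prodMk_comm (H.measurable_noise s)
    (H.measurable_noise t) (H.measurable_unif s) (H.measurable_unif t)
    (H.unif_indep.indepFun hij') hnu
  have hxn := H.arrivals_indep.comp
    (φ := fun a : (ℕ → ℕ) × (ℕ → Fin d → ℝ) × (ℕ → Fin d → ℝ) => (a.2.1 s, a.2.1 t))
    (ψ := fun q : (ℕ → ℝ) × (ℕ → ℝ) => ((q.1 s, q.2 s), (q.1 t, q.2 t)))
    (by fun_prop) (by fun_prop)
  exact hfeat.prodMk_prodMk_comm (H.measurable_feat s) (H.measurable_feat t)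
    ((H.measurable_noise s).prodMk (H.measurable_unif s))
    ((H.measurable_noise t).prodMk (H.measurable_unif t)) h1 hxn

/-- Permits fixing feature and price while averaging over the noise, which yields the means of the
gradient and of the weighted second moments. -/
theorem indepFun_feat_unif_noise [IsProbabilityMeasure μ] (H : IsMarket μ ν B l₀ Ca A θ₀ P τ S) (t : ℕ) :
    IndepFun (fun ω => ((S ω).feat t, (S ω).unif t)) (fun ω => (S ω).noise t) μ :=
  (H.indepFun_noise.comp (φ := fun z : ℕ → ℝ => z t)
    (ψ := fun q : (ℕ → ℝ) × (ℕ → ℕ) × (ℕ → Fin d → ℝ) × (ℕ → Fin d → ℝ) =>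
      (q.2.2.1 t, q.1 t)) (by fun_prop) (by fun_prop)).symm

end IsMarket

/-- The mean squared error of the maximum likelihood estimator is inversely proportional to the
length of the exploration phase. -/
theorem exists_integral_sq_thetaHat_le {ν : Measure ℝ} [IsProbabilityMeasure ν]
    (hν : NoiseAssumptions ν) {B Wx Wθ lmin : ℝ} (hB : 0 < B) (hWx : 0 < Wx) (hWθ : 0 < Wθ)
    (hlmin : 0 < lmin) :
    ∃ C : ℝ, 0 < C ∧ ∀ {Ω : Type*} [MeasurableSpace Ω] {μ : Measure Ω} [IsProbabilityMeasure μ]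
      {l₀ : ℕ} {Ca : ℝ} {d : ℕ} {A : Matrix (Fin d) (Fin d) ℝ} {θ₀ : Fin (d + 1) → ℝ}
      {P : Measure (Fin d → ℝ)} [IsProbabilityMeasure P] {τ : ℝ} {S : Ω → Path d},
      IsMarket μ ν B l₀ Ca A θ₀ P τ S → θ₀ ∈ paramSet d Wθ →
      (∀ᵐ x ∂P, euclNorm (aug x) ≤ Wx) → (∀ l ∈ spectrum ℝ (secondMoment P), lmin ≤ l) →
      ∀ {est : (n : ℕ) → (Fin n → Obs d) → (Fin (d + 1) → ℝ)}, IsMLE ν Wθ est →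
      ∀ {k : ℕ}, 1 ≤ k →
      ∫ ω, euclNorm (thetaHat l₀ Ca est θ₀ (S ω) k - θ₀) ^ 2 ∂μ ≤
        C / ((exploreLen l₀ Ca k : ℝ) + 1) := by
  -- `b` bounds `|p - θᵀ x|` over all of `Θ`, `π` is the probability of noise at least `b`, `κ`
  -- bounds the spectrum of `π Σ` below, and `D` bounds `d + 1`.
  set b := B + Wθ * Wx with hb
  have hb0 : 0 ≤ b := by positivity
  obtain ⟨m, hm, hcurv⟩ := hν.exists_neg_log_survival_ge hb0
  obtain ⟨K, hK, hres⟩ := hν.exists_abs_residual_le b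
  set π := 1 - noiseCDF ν b with hπ
  have hπ0 : 0 < π := sub_pos.2 (hν.cdf_lt_one b)
  set κ := π * lmin with hκ
  have hκ0 : 0 < κ := by positivity
  set D := Wx ^ 2 / lmin with hD
  set C := 2 / (κ * m) ^ 2 * (D * (K * Wx) ^ 2) + 8 * Wθ ^ 2 / κ ^ 2 * (D * (D * (Wx * Wx) ^ 2))
    with hC
  have hC0 : 0 < C := by positivity
  -- For `n ≥ 1`, `C / n ≤ 2 C / (n + 1)`. The summand `4 Wθ²`, the squared diameter bound, covers
  -- an empty exploration phase.
  refine ⟨2 * C + 4 * Wθ ^ 2, by positivity, ?_⟩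
  intro Ω _ μ _ l₀ Ca d A θ₀ P _ τ S H hθ₀ hP hl est hest k hk
  have hSm := H.measurable_path
  have hmeas : Measurable fun ω => euclNorm (thetaHat l₀ Ca est θ₀ (S ω) k - θ₀) ^ 2 := by
    have := (measurable_thetaHat l₀ Ca hest.measurable θ₀ k).comp hSm
    exact (measurable_euclNorm.comp (this.sub_const θ₀)).pow_const 2
  have hbdd : ∀ ω, euclNorm (thetaHat l₀ Ca est θ₀ (S ω) k - θ₀) ^ 2 ≤ 4 * Wθ ^ 2 := fun ω => by
    have h1 := euclNorm_sub_le_of_mem_paramSet (hest.mem _ (exploreData l₀ Ca θ₀ (S ω) k)) hθ₀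
    have h2 := euclNorm_nonneg (thetaHat l₀ Ca est θ₀ (S ω) k - θ₀)
    have : (2 * Wθ) ^ 2 = 4 * Wθ ^ 2 := by ring
    rw [← this]
    exact pow_le_pow_left₀ h2 h1 2
  have hint : Integrable (fun ω => euclNorm (thetaHat l₀ Ca est θ₀ (S ω) k - θ₀) ^ 2) μ :=
    Integrable.of_measurable_of_ae_abs_le hmeas (K := 4 * Wθ ^ 2)
      (Filter.Eventually.of_forall fun ω => by rw [abs_of_nonneg (sq_nonneg _)]; exact hbdd ω)
  set n := exploreLen l₀ Ca k with hn
  rcases Nat.eq_zero_or_pos n with h0 | hpos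
  · rw [h0, Nat.cast_zero, zero_add, div_one]
    exact (integral_le_of_ae_le hint (Filter.Eventually.of_forall hbdd)).trans (by linarith)
  have hn0 : (0 : ℝ) < n := Nat.cast_pos.2 hpos
  have hn1 : (1 : ℝ) ≤ n := Nat.one_le_cast.2 hpos
  set t : Fin n → ℕ := fun i => epLen l₀ k + i with ht
  -- `g` holds the summands of the gradient and `q` those of the second moment matrix restricted to
  -- noise at least `b`.
  set g : Fin n → Fin (d + 1) → Ω → ℝ := fun i j ω =>
    residual ν ((S ω).unif (t i) - score θ₀ ((S ω).feat (t i))) ((S ω).noise (t i)) *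
      aug ((S ω).feat (t i)) j with hg
  set q : Fin n → Fin (d + 1) → Fin (d + 1) → Ω → ℝ := fun i j l ω =>
    (Set.Ici b).indicator 1 ((S ω).noise (t i)) *
      (aug ((S ω).feat (t i)) j * aug ((S ω).feat (t i)) l) with hq
  have hx : ∀ᵐ ω ∂μ, ∀ r, euclNorm (aug ((S ω).feat r)) ≤ Wx := ae_all_iff.2 (H.ae_feat hP)
  have hp : ∀ᵐ ω ∂μ, ∀ r, (S ω).unif r ∈ Set.Ioo 0 B := ae_all_iff.2 H.ae_unif_mem
  have hu : ∀ᵐ ω ∂μ, ∀ r, |(S ω).unif r - score θ₀ ((S ω).feat r)| ≤ b := by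
    filter_upwards [hx, hp] with ω hx hp r
    have h1 := abs_score_le_of_mem_paramSet ((S ω).feat r) hθ₀ (hx r)
    have h2 := hp r
    rw [abs_le] at h1 ⊢
    constructor <;> linarith [h2.1, h2.2]
  have haug : ∀ᵐ ω ∂μ, ∀ r j, |aug ((S ω).feat r) j| ≤ Wx := by
    filter_upwards [hx] with ω hx r j using (abs_apply_le_euclNorm _ j).trans (hx r)
  have hmg' : ∀ j, Measurable fun o : (Fin d → ℝ) × ℝ × ℝ =>
      residual ν (o.2.2 - score θ₀ o.1) o.2.1 * aug o.1 j := fun j =>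
    (hν.measurable_residual.comp (by fun_prop :
      Measurable fun o : (Fin d → ℝ) × ℝ × ℝ => (o.2.2 - score θ₀ o.1, o.2.1))).mul (by fun_prop)
  have hmq' : ∀ j l, Measurable fun o : (Fin d → ℝ) × ℝ × ℝ =>
      (Set.Ici b).indicator 1 o.2.1 * (aug o.1 j * aug o.1 l) := fun j l =>
    (((measurable_one (α := ℝ) (β := ℝ)).indicator measurableSet_Ici).comp (by fun_prop)).mul
      (by fun_prop)
  have hobs : ∀ r, Measurable fun ω => ((S ω).feat r, (S ω).noise r, (S ω).unif r) := fun r =>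
    (H.measurable_feat r).prodMk ((H.measurable_noise r).prodMk (H.measurable_unif r))
  have hmg : ∀ i j, Measurable (g i j) := fun i j => (hmg' j).comp (hobs (t i))
  have hmq : ∀ i j l, Measurable (q i j l) := fun i j l => (hmq' j l).comp (hobs (t i))
  have hgK : ∀ i j, ∀ᵐ ω ∂μ, |g i j ω| ≤ K * Wx := fun i j => by
    filter_upwards [hu, haug] with ω hu haug
    rw [hg, abs_mul]
    exact mul_le_mul (hres _ _ (hu _)) (haug _ _) (abs_nonneg _) hK.le
  have hqK : ∀ i j l, ∀ᵐ ω ∂μ, |q i j l ω| ≤ Wx * Wx := fun i j l => by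
    filter_upwards [haug] with ω haug
    rw [hq, abs_mul, abs_mul]
    have : |(Set.Ici b).indicator (1 : ℝ → ℝ) ((S ω).noise (t i))| ≤ 1 := by
      simp only [Set.indicator]; split_ifs <;> simp
    calc _ ≤ 1 * (Wx * Wx) := mul_le_mul this (mul_le_mul (haug _ _) (haug _ _) (abs_nonneg _)
            hWx.le) (by positivity) zero_le_one
      _ = Wx * Wx := one_mul _
  have hgmean : ∀ i j, ∫ ω, g i j ω ∂μ = 0 := fun i j => by
    have h := (H.indepFun_feat_unif_noise (t i)).integral_comp_prodMk
      ((H.measurable_feat _).prodMk (H.measurable_unif _)) (H.measurable_noise _)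
      (G := fun o : ((Fin d → ℝ) × ℝ) × ℝ =>
        residual ν (o.1.2 - score θ₀ o.1.1) o.2 * aug o.1.1 j)
      ((hmg' j).comp (by fun_prop : Measurable fun o : ((Fin d → ℝ) × ℝ) × ℝ =>
        (o.1.1, o.2, o.1.2)))
      (Integrable.of_measurable_of_ae_abs_le (hmg i j) (hgK i j))
    refine h.trans ?_
    simp only [H.noise_law, integral_mul_const, hν.integral_residual, zero_mul, integral_zero]
  have hqmean : ∀ i j l, ∫ ω, q i j l ω ∂μ = π * secondMoment P j l := fun i j l => by
    have h := (H.indepFun_feat_unif_noise (t i)).integral_comp_prodMk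
      ((H.measurable_feat _).prodMk (H.measurable_unif _)) (H.measurable_noise _)
      (G := fun o : ((Fin d → ℝ) × ℝ) × ℝ =>
        (Set.Ici b).indicator 1 o.2 * (aug o.1.1 j * aug o.1.1 l))
      ((hmq' j l).comp (by fun_prop : Measurable fun o : ((Fin d → ℝ) × ℝ) × ℝ =>
        (o.1.1, o.2, o.1.2)))
      (Integrable.of_measurable_of_ae_abs_le (hmq i j l) (hqK i j l))
    refine h.trans ?_
    simp only [H.noise_law, integral_mul_const, integral_indicator_one measurableSet_Ici,
      hν.measureReal_Ici, integral_const_mul]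
    rw [← hπ]
    congr 1
    simp only [secondMoment, Matrix.of_apply]
    rw [← H.feat_law (t i), integral_map (H.measurable_feat _).aemeasurable
      (by fun_prop : Measurable fun x : Fin d → ℝ => aug x j * aug x l).aestronglyMeasurable]
  have hgvar : ∀ j, ∫ ω, (0 - (1 / (n : ℝ)) * ∑ i, g i j ω) ^ 2 ∂μ ≤ (K * Wx) ^ 2 / n := fun j =>
    integral_sq_sub_average_le hpos (hmg · j) (hgK · j) (hgmean · j) fun i i' hii =>
      (H.pairwise_indepFun_obs hk hii).comp (hmg' j) (hmg' j)
  have hqvar : ∀ j l, ∫ ω, (π * secondMoment P j l - (1 / (n : ℝ)) * ∑ i, q i j l ω) ^ 2 ∂μ ≤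
      (Wx * Wx) ^ 2 / n := fun j l =>
    integral_sq_sub_average_le hpos (hmq · j l) (hqK · j l) (hqmean · j l) fun i i' hii =>
      (H.pairwise_indepFun_obs hk hii).comp (hmq' j l) (hmq' j l)
  have hpoint : ∀ᵐ ω ∂μ, euclNorm (thetaHat l₀ Ca est θ₀ (S ω) k - θ₀) ^ 2 ≤
      2 / (κ * m) ^ 2 * ∑ j, (0 - (1 / (n : ℝ)) * ∑ i, g i j ω) ^ 2 +
      8 * Wθ ^ 2 / κ ^ 2 *
        ∑ j, ∑ l, (π * secondMoment P j l - (1 / (n : ℝ)) * ∑ i, q i j l ω) ^ 2 := by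
    filter_upwards [hx, hp] with ω hx hp
    have h := sq_euclNorm_mle_sub_le hν hpos hb hm hκ0 hB hcurv
      (hest.mem n (exploreData l₀ Ca θ₀ (S ω) k)) hθ₀ (data := exploreData l₀ Ca θ₀ (S ω) k)
      (z := fun i => (S ω).noise (t i)) (fun i => hx _) (fun i => hp _)
      (fun i => decide_eq_true_iff) (hest.isMax n _ θ₀ hθ₀)
      (M := fun j l => π * secondMoment P j l) (fun v => by
        have := mul_le_mul_of_nonneg_left (mul_sq_euclNorm_le_secondMoment hl v) hπ0.le
        rw [← mul_assoc, Finset.mul_sum] at this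
        refine this.trans_eq (Finset.sum_congr rfl fun j _ => ?_)
        rw [Finset.mul_sum]
        exact Finset.sum_congr rfl fun l _ => by ring)
    simp only [zero_sub, neg_sq]
    exact h
  have hig : ∀ j, Integrable (fun ω => (0 - (1 / (n : ℝ)) * ∑ i, g i j ω) ^ 2) μ := fun j =>
    integrable_sq_sub_average 0 (hmg · j) (hgK · j)
  have hiq : ∀ j l, Integrable
      (fun ω => (π * secondMoment P j l - (1 / (n : ℝ)) * ∑ i, q i j l ω) ^ 2) μ := fun j l =>
    integrable_sq_sub_average _ (hmq · j l) (hqK · j l)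
  -- The sums over one and over two coordinate indices cost factors `D` and `D²`, hence constants.
  have hdim : ((d : ℝ) + 1) ≤ D := (le_div_iff₀ hlmin).2 (dim_mul_le hP hl)
  have hmain : ∫ ω, euclNorm (thetaHat l₀ Ca est θ₀ (S ω) k - θ₀) ^ 2 ∂μ ≤ C / n := by
    have hig' := integrable_finsetSum Finset.univ fun j _ => hig j
    have hiq' := integrable_finsetSum Finset.univ fun j _ =>
      integrable_finsetSum Finset.univ fun l _ => hiq j l
    refine (integral_mono_ae hint ((hig'.const_mul _).add (hiq'.const_mul _)) hpoint).trans ?_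
    rw [integral_add' (hig'.const_mul _) (hiq'.const_mul _), integral_const_mul, integral_const_mul,
      integral_finsetSum _ fun j _ => hig j, integral_finsetSum _ fun j _ =>
      integrable_finsetSum Finset.univ fun l _ => hiq j l]
    have e1 : ∑ j, ∫ ω, (0 - (1 / (n : ℝ)) * ∑ i, g i j ω) ^ 2 ∂μ ≤ D * ((K * Wx) ^ 2 / n) := by
      refine (Finset.sum_le_sum fun j _ => hgvar j).trans ?_
      rw [Finset.sum_const, Finset.card_univ, Fintype.card_fin, nsmul_eq_mul]
      push_cast
      gcongr
    have e2 : ∑ j, ∫ ω, ∑ l, (π * secondMoment P j l - (1 / (n : ℝ)) * ∑ i, q i j l ω) ^ 2 ∂μ ≤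
        D * (D * ((Wx * Wx) ^ 2 / n)) := by
      have e3 : ∀ j ∈ (Finset.univ : Finset (Fin (d + 1))),
          ∫ ω, ∑ l, (π * secondMoment P j l - (1 / (n : ℝ)) * ∑ i, q i j l ω) ^ 2 ∂μ ≤
          D * ((Wx * Wx) ^ 2 / n) := fun j _ => by
        rw [integral_finsetSum _ fun l _ => hiq j l]
        refine (Finset.sum_le_sum fun l _ => hqvar j l).trans ?_
        rw [Finset.sum_const, Finset.card_univ, Fintype.card_fin, nsmul_eq_mul]
        push_cast
        gcongr
      refine (Finset.sum_le_sum e3).trans ?_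
      rw [Finset.sum_const, Finset.card_univ, Fintype.card_fin, nsmul_eq_mul]
      push_cast
      gcongr
    calc _ ≤ 2 / (κ * m) ^ 2 * (D * ((K * Wx) ^ 2 / n)) +
          8 * Wθ ^ 2 / κ ^ 2 * (D * (D * ((Wx * Wx) ^ 2 / n))) := by gcongr
      _ = C / n := by rw [hC]; ring
  refine hmain.trans ?_
  rw [div_le_div_iff₀ hn0 (by positivity)]
  nlinarith [mul_nonneg (sub_nonneg.2 hn1) hC0.le, sq_nonneg Wθ, mul_nonneg (sq_nonneg Wθ) hn0.le]

/-! # Episodes -/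

section Episodes

variable {l₀ : ℕ} {Ca : ℝ} {k k' t : ℕ}

theorem epLen_one : epLen l₀ 1 = l₀ := by simp [epLen]

theorem epLen_succ (hk : 1 ≤ k) : epLen l₀ (k + 1) = 2 * epLen l₀ k := by
  obtain ⟨j, rfl⟩ := Nat.exists_eq_add_of_le' hk
  simp only [epLen, Nat.add_sub_cancel, pow_succ]
  ring

theorem epLen_mono (h : k ≤ k') : epLen l₀ k ≤ epLen l₀ k' := by
  unfold epLen
  gcongr
  · norm_num

theorem le_epLen : l₀ ≤ epLen l₀ k := Nat.le_mul_of_pos_left _ (by positivity)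

/-- `Ca ≤ ℓ₀ ≤ ℓ_k`, so `√(Ca ℓ_k) ≤ ℓ_k` and the exploration phase fits into its episode. -/
theorem exploreLen_le (hCa : Ca ≤ l₀) : exploreLen l₀ Ca k ≤ epLen l₀ k := by
  refine Nat.floor_le_of_le (Real.sqrt_le_iff.2 ⟨Nat.cast_nonneg _, ?_⟩)
  rw [sq]
  have : (l₀ : ℝ) ≤ epLen l₀ k := Nat.cast_le.2 le_epLen
  gcongr
  exact hCa.trans this

theorem mem_episode_of_mem_explorePhase (hCa : Ca ≤ l₀) (hk : 1 ≤ k)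
    (ht : t ∈ explorePhase l₀ Ca k) : epLen l₀ k ≤ t ∧ t < epLen l₀ (k + 1) := by
  rw [explorePhase, Finset.mem_Ico] at ht
  have := exploreLen_le (k := k) hCa
  rw [epLen_succ hk]
  omega

theorem mem_episode_of_mem_exploitPhase (ht : t ∈ exploitPhase l₀ Ca k) :
    epLen l₀ k ≤ t ∧ t < epLen l₀ (k + 1) := by
  rw [exploitPhase, Finset.mem_Ico] at ht
  omega

theorem episode_unique (h : epLen l₀ k ≤ t ∧ t < epLen l₀ (k + 1))
    (h' : epLen l₀ k' ≤ t ∧ t < epLen l₀ (k' + 1)) : k = k' := by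
  rcases lt_trichotomy k k' with hlt | heq | hlt
  · have : epLen l₀ (k + 1) ≤ epLen l₀ k' := epLen_mono hlt; omega
  · exact heq
  · have : epLen l₀ (k' + 1) ≤ epLen l₀ k := epLen_mono hlt; omega

theorem IsExplore.not_isExploit (hCa : Ca ≤ l₀) (h : IsExplore l₀ Ca t) : ¬IsExploit l₀ Ca t := by
  rintro ⟨k', -, hk'⟩
  obtain ⟨k, hk1, hk⟩ := h
  obtain rfl := episode_unique (mem_episode_of_mem_explorePhase hCa hk1 hk)
    (mem_episode_of_mem_exploitPhase hk')
  rw [explorePhase, Finset.mem_Ico] at hk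
  rw [exploitPhase, Finset.mem_Ico] at hk'
  omega

theorem one_le_episodeOf : 1 ≤ episodeOf l₀ t := Nat.le_add_left _ _

theorem mem_exploitPhase_of_not_isExplore (h₀ : 0 < l₀) (ht : l₀ ≤ t)
    (h : ¬IsExplore l₀ Ca t) : t ∈ exploitPhase l₀ Ca (episodeOf l₀ t) := by
  have h1 := mem_episodeOf h₀ ht
  rw [exploitPhase, Finset.mem_Ico]
  refine ⟨not_lt.1 fun h2 => h ?_, h1.2⟩
  exact ⟨episodeOf l₀ t, one_le_episodeOf, Finset.mem_Ico.2 ⟨h1.1, h2⟩⟩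

open scoped Classical in
-- The phase lengths are bounded by a geometric progression of ratio `√2`, so their sum is
-- comparable to the last one.
theorem card_isExplore_le_of_epLen (hCa : Ca ≤ l₀) (k : ℕ) :
    (((Finset.Ico l₀ (epLen l₀ (k + 1))).filter (IsExplore l₀ Ca)).card : ℝ) ≤
      4 * √((l₀ : ℝ) * epLen l₀ k) := by
  have hlen : ∀ k, (exploreLen l₀ Ca k : ℝ) ≤ √((l₀ : ℝ) * epLen l₀ k) := fun k => by
    refine (Nat.floor_le (Real.sqrt_nonneg _)).trans (Real.sqrt_le_sqrt ?_)
    gcongr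
  induction k with
  -- By truncated subtraction `epLen l₀ 0 = l₀ = epLen l₀ 1`; the range of periods is empty, and the
  -- doubling starts only at `k = 1`.
  | zero => simp [epLen_one]; positivity
  | succ k ih =>
    have hsub : (Finset.Ico l₀ (epLen l₀ (k + 1 + 1))).filter (IsExplore l₀ Ca) ⊆
        (Finset.Ico l₀ (epLen l₀ (k + 1))).filter (IsExplore l₀ Ca) ∪
          explorePhase l₀ Ca (k + 1) := by
      intro t ht
      rw [Finset.mem_filter, Finset.mem_Ico] at ht
      rw [Finset.mem_union, Finset.mem_filter, Finset.mem_Ico]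
      by_cases h : t < epLen l₀ (k + 1)
      · exact Or.inl ⟨⟨ht.1.1, h⟩, ht.2⟩
      · obtain ⟨j, hj, hjt⟩ := ht.2
        obtain rfl := episode_unique (mem_episode_of_mem_explorePhase hCa hj hjt)
          ⟨not_lt.1 h, ht.1.2⟩
        exact Or.inr hjt
    have hcard : (((Finset.Ico l₀ (epLen l₀ (k + 1 + 1))).filter (IsExplore l₀ Ca)).card : ℝ) ≤
        ((Finset.Ico l₀ (epLen l₀ (k + 1))).filter (IsExplore l₀ Ca)).card +
          exploreLen l₀ Ca (k + 1) := by
      have := (Finset.card_le_card hsub).trans (Finset.card_union_le _ _)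
      rw [explorePhase, Nat.card_Ico, Nat.add_sub_cancel_left] at this
      exact_mod_cast this
    refine hcard.trans ?_
    rcases Nat.eq_zero_or_pos k with rfl | hk
    · have := hlen 1
      rw [zero_add, epLen_one] at *
      simp only [Finset.Ico_self, Finset.filter_empty, Finset.card_empty, Nat.cast_zero, zero_add]
      linarith [Real.sqrt_nonneg ((l₀ : ℝ) * l₀)]
    · have h1 := hlen (k + 1)
      have h2 : √((l₀ : ℝ) * epLen l₀ (k + 1)) = √2 * √((l₀ : ℝ) * epLen l₀ k) := by
        rw [epLen_succ hk, ← Real.sqrt_mul (by norm_num)]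
        push_cast
        congr 1; ring
      -- The induction step needs `4 + √2 ≤ 4 √2`, that is `√2 ≥ 4/3`; this is the origin of the
      -- constant 4.
      have h3 : (4 / 3 : ℝ) ≤ √2 := Real.le_sqrt_of_sq_le (by norm_num)
      rw [h2] at h1 ⊢
      nlinarith [Real.sqrt_nonneg ((l₀ : ℝ) * epLen l₀ k)]

open scoped Classical in
theorem card_isExplore_le (h₀ : 0 < l₀) (hCa : Ca ≤ l₀) {n : ℕ} (hn : l₀ ≤ n) :
    (((Finset.Ico l₀ n).filter (IsExplore l₀ Ca)).card : ℝ) ≤ 4 * √((l₀ : ℝ) * n) := by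
  have h := mem_episodeOf h₀ hn
  have h1 : ((Finset.Ico l₀ n).filter (IsExplore l₀ Ca)).card ≤
      ((Finset.Ico l₀ (epLen l₀ (episodeOf l₀ n + 1))).filter (IsExplore l₀ Ca)).card :=
    Finset.card_le_card (Finset.filter_subset_filter _ (Finset.Ico_subset_Ico_right h.2.le))
  refine (Nat.cast_le.2 h1).trans ((card_isExplore_le_of_epLen hCa _).trans ?_)
  have : (epLen l₀ (episodeOf l₀ n) : ℝ) ≤ n := Nat.cast_le.2 h.1
  gcongr

end Episodes

/-! # The error of the exploitation price -/

/-- The properties of a sample path that hold almost surely; `Γ = A⁻¹ β₀`. -/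
structure IsRegularPath {d : ℕ} (ν : Measure ℝ) (B : ℝ) (l₀ : ℕ) (Ca : ℝ)
    (θ₀ : Fin (d + 1) → ℝ) (Γ : Fin d → ℝ) (Wx τ : ℝ) (s : Path d) : Prop where
  feat_le : ∀ t, euclNorm (aug (s.feat t)) ≤ Wx
  feat_ident : ∀ r t, s.ident r = s.ident t → s.feat r = s.feat t
  manip_eq : ∀ t, IsExploit l₀ Ca t →
    s.manip t = s.feat t - deriv (pricing ν) (score θ₀ (s.manip t)) • Γ
  unif_mem : ∀ t, s.unif t ∈ Set.Ioo 0 B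
  repeat_rate : RepeatRateAtLeast l₀ Ca τ s

namespace IsRegularPath

variable {d : ℕ} {ν : Measure ℝ} {B : ℝ} {l₀ : ℕ} {Ca : ℝ} {θ₀ : Fin (d + 1) → ℝ} {Γ : Fin d → ℝ}
  {Wx τ : ℝ} {s : Path d}

/-- A positive repeat rate at the end of the first episode provides a buyer seen in both kinds of
phase; the later of the two visits completes a matched pair before period `2 ℓ₀`. -/
theorem matchTimes_nonempty (hs : IsRegularPath ν B l₀ Ca θ₀ Γ Wx τ s) (h₀ : 0 < l₀)
    (hCa : Ca ≤ l₀) (hτ : 0 < τ) {t : ℕ} (ht : 2 * l₀ ≤ t) :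
    (matchTimes l₀ Ca s t).Nonempty := by
  classical
  have h := hs.repeat_rate 1 le_rfl
  have he : epLen l₀ (1 + 1) = 2 * l₀ := by rw [epLen_succ le_rfl, epLen_one]
  rw [he] at h
  have hpos : 0 < τ * ((Finset.Ico l₀ (2 * l₀)).card : ℝ) := by
    rw [Nat.card_Ico, two_mul, Nat.add_sub_cancel]
    positivity
  obtain ⟨t₀, ht₀⟩ := Finset.card_pos.1 (Nat.cast_pos.1 (hpos.trans_le h))
  simp only [Finset.mem_filter] at ht₀
  obtain ⟨-, ⟨r, hr, hre, hri⟩, r', hr', hre', hri'⟩ := ht₀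
  rw [Finset.mem_Ico] at hr hr'
  rcases lt_trichotomy r r' with hlt | rfl | hlt
  · refine ⟨r', Finset.mem_filter.2 ⟨Finset.mem_range.2 (by omega), Or.inl ⟨hre', r, ?_⟩⟩⟩
    exact Finset.mem_filter.2 ⟨Finset.mem_range.2 hlt, hre, hri.trans hri'.symm⟩
  · exact absurd hre' (hre.not_isExploit hCa)
  · refine ⟨r, Finset.mem_filter.2 ⟨Finset.mem_range.2 (by omega), Or.inr ⟨hre, r', ?_⟩⟩⟩
    exact Finset.mem_filter.2 ⟨Finset.mem_range.2 hlt, hre', hri'.trans hri.symm⟩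

theorem recordedTrue_eq (hs : IsRegularPath ν B l₀ Ca θ₀ Γ Wx τ s) {t : ℕ}
    (h : (exploreRecords l₀ Ca s t).Nonempty) : recordedTrue l₀ Ca s t = s.feat t := by
  classical
  obtain ⟨r, hr, e⟩ := Finset.exists_mem_eq_sup _ h id
  rw [recordedTrue, e]
  exact hs.feat_ident _ _ (Finset.mem_filter.1 hr).2.2

theorem euclNorm_aug_manip_le (hs : IsRegularPath ν B l₀ Ca θ₀ Γ Wx τ s) (hν : NoiseAssumptions ν)
    {t : ℕ} (ht : IsExploit l₀ Ca t) : euclNorm (aug (s.manip t)) ≤ Wx + euclNorm Γ := by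
  rw [hs.manip_eq t ht]
  refine (euclNorm_aug_sub_le _ _).trans (add_le_add (hs.feat_le t) ?_)
  rw [euclNorm_smul, abs_of_pos (hν.deriv_pricing_pos _)]
  exact mul_le_of_le_one_left (euclNorm_nonneg _) (hν.deriv_pricing_le_one _)

/-- A matched pair belongs to an exploitation period. -/
theorem pair_eq (hs : IsRegularPath ν B l₀ Ca θ₀ Γ Wx τ s) (hCa : Ca ≤ l₀) {r t : ℕ}
    (hr : r ∈ matchTimes l₀ Ca s t) :
    ∃ q, IsExploit l₀ Ca q ∧ pairManip l₀ Ca s r = s.manip q ∧ pairTrue l₀ Ca s r = s.feat q := by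
  classical
  rcases (Finset.mem_filter.1 hr).2 with ⟨h1, h2⟩ | ⟨h1, h2⟩
  · have hne : ¬IsExplore l₀ Ca r := fun h => h.not_isExploit hCa h1
    exact ⟨r, h1, if_neg hne, (if_neg hne).trans (hs.recordedTrue_eq h2)⟩
  -- A pair completed by exploration uses the manipulated feature of an earlier period `q` of the
  -- same buyer, whose true feature is unchanged.
  · obtain ⟨q, hq, e⟩ := Finset.exists_mem_eq_sup _ h2 id
    obtain ⟨-, hq1, hq2⟩ := Finset.mem_filter.1 hq
    refine ⟨q, hq1, (if_pos h1).trans ?_, (if_pos h1).trans (hs.feat_ident _ _ hq2.symm)⟩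
    rw [recordedManip, e]; rfl

/-- The least squares estimator is a multiple of `Γ`, the factor being close to `-1`. -/
theorem exists_gammaHat_eq (hs : IsRegularPath ν B l₀ Ca θ₀ Γ Wx τ s) (hν : NoiseAssumptions ν)
    (hCa : Ca ≤ l₀) {W G : ℝ} (hθ₀ : θ₀ ∈ paramSet d W) {θ : Fin (d + 1) → ℝ}
    (hθ : θ ∈ paramSet d W) (hΓ : euclNorm Γ ≤ G) {m K : ℝ} (hm : 0 < m) (hK : 0 < K)
    (hlow : ∀ v, |v| ≤ W * (Wx + G) → m ≤ deriv (pricing ν) v)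
    (hlip : ∀ a b, |a| ≤ W * (Wx + G) → |b| ≤ W * (Wx + G) →
      |deriv (pricing ν) a - deriv (pricing ν) b| ≤ K * |a - b|) {t : ℕ}
    (hne : (matchTimes l₀ Ca s t).Nonempty) :
    ∃ ρ : ℝ, gammaHat ν l₀ Ca θ s t = (-ρ) • Γ ∧
      |ρ - 1| ≤ K * (Wx + G) / m * euclNorm (θ - θ₀) := by
  classical
  set N := matchTimes l₀ Ca s t with hN
  set u : ℕ → ℝ := fun r => deriv (pricing ν) (score θ (pairManip l₀ Ca s r)) with hu
  set w : ℕ → ℝ := fun r => deriv (pricing ν) (score θ₀ (pairManip l₀ Ca s r)) with hw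
  have hx : ∀ r ∈ N, euclNorm (aug (pairManip l₀ Ca s r)) ≤ Wx + G := fun r hr => by
    obtain ⟨q, hq, e, -⟩ := hs.pair_eq hCa hr
    rw [e]
    exact (hs.euclNorm_aug_manip_le hν hq).trans (by gcongr)
  -- The manipulation rule has no noise term, so each difference is an exact multiple of `Γ`.
  have hδ : ∀ r ∈ N, pairManip l₀ Ca s r - pairTrue l₀ Ca s r = (-w r) • Γ := fun r hr => by
    obtain ⟨q, hq, e, e'⟩ := hs.pair_eq hCa hr
    have h := hs.manip_eq q hq
    rw [hw, e']
    simp only [e]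
    conv_lhs => rw [h]
    rw [neg_smul, sub_sub_cancel_left]
  have hum : ∀ r ∈ N, m ≤ u r := fun r hr => hlow _ (abs_score_le_of_mem_paramSet _ hθ (hx r hr))
  have huw : ∀ r ∈ N, |w r - u r| ≤ K * ((Wx + G) * euclNorm (θ - θ₀)) := fun r hr => by
    refine (hlip _ _ (abs_score_le_of_mem_paramSet _ hθ₀ (hx r hr))
      (abs_score_le_of_mem_paramSet _ hθ (hx r hr))).trans ?_
    rw [abs_sub_comm]
    refine mul_le_mul_of_nonneg_left ?_ hK.le
    refine (abs_score_sub_score_le _ _ _).trans ?_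
    rw [mul_comm]
    exact mul_le_mul_of_nonneg_right (hx r hr) (euclNorm_nonneg _)
  set Q := ∑ r ∈ N, u r ^ 2 with hQ
  have hQ0 : 0 < Q := Finset.sum_pos (fun r hr => pow_pos (hm.trans_le (hum r hr)) 2) hne
  refine ⟨Q⁻¹ * ∑ r ∈ N, u r * w r, ?_, ?_⟩
  · change Q⁻¹ • ∑ r ∈ N, u r • (pairManip l₀ Ca s r - pairTrue l₀ Ca s r) = _
    rw [← mul_neg, mul_smul, ← Finset.sum_neg_distrib, Finset.sum_smul]
    congr 1
    refine Finset.sum_congr rfl fun r hr => ?_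
    rw [hδ r hr, smul_smul, mul_neg]
  -- `ρ` is the regression coefficient of `w` on `u`, so `ρ - 1` is that of `w - u`.
  · have e : Q⁻¹ * ∑ r ∈ N, u r * w r - 1 = (∑ r ∈ N, u r * (w r - u r)) / Q := by
      have : ∑ r ∈ N, u r * (w r - u r) = ∑ r ∈ N, u r * w r - Q := by
        rw [hQ, ← Finset.sum_sub_distrib]
        exact Finset.sum_congr rfl fun r _ => by ring
      rw [this]; field_simp
    rw [e, abs_div, abs_of_pos hQ0, div_le_iff₀ hQ0, hQ, Finset.mul_sum]
    refine (Finset.abs_sum_le_sum_abs _ _).trans (Finset.sum_le_sum fun r hr => ?_)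
    have h1 := hum r hr
    have h2 : 0 < u r := hm.trans_le h1
    have h3 := huw r hr
    have h4 := (abs_nonneg _).trans h3
    rw [abs_mul, abs_of_pos h2]
    calc u r * |w r - u r| ≤ u r * (K * ((Wx + G) * euclNorm (θ - θ₀))) := by gcongr
      -- The bound `u ≥ m` turns `u` into `u² / m`, so the sum of squares cancels and the number of
      -- pairs plays no role.
      _ ≤ u r * (K * ((Wx + G) * euclNorm (θ - θ₀))) * (u r / m) :=
        le_mul_of_one_le_right (by positivity) ((one_le_div₀ hm).2 h1)
      _ = K * (Wx + G) / m * euclNorm (θ - θ₀) * u r ^ 2 := by ring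

end IsRegularPath

/-- Once there are matched pairs, the error of the exploitation price is at most proportional to
the error of the parameter. -/
theorem exists_abs_exploitPrice_sub_le {ν : Measure ℝ} (hν : NoiseAssumptions ν) {Wx W G : ℝ}
    (hWx : 0 < Wx) (hW : 0 < W) (hG : 0 < G) :
    ∃ C, 0 < C ∧ ∀ {d : ℕ} {B : ℝ} {l₀ : ℕ} {Ca : ℝ} {θ₀ θ : Fin (d + 1) → ℝ} {Γ : Fin d → ℝ}
      {τ : ℝ} {s : Path d}, Ca ≤ l₀ → IsRegularPath ν B l₀ Ca θ₀ Γ Wx τ s →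
      θ₀ ∈ paramSet d W → θ ∈ paramSet d W → euclNorm Γ ≤ G → ∀ {t : ℕ}, IsExploit l₀ Ca t →
      (exploreRecords l₀ Ca s t).Nonempty ∨ (matchTimes l₀ Ca s t).Nonempty →
      |exploitPrice ν l₀ Ca θ s t - oraclePrice ν θ₀ s t| ≤ C * euclNorm (θ - θ₀) := by
  have hR : 0 ≤ W * (Wx + G) := by positivity
  obtain ⟨m, hm, hlow⟩ := hν.exists_deriv_pricing_lower hR
  obtain ⟨K, hK, hlip⟩ := hν.exists_lipschitz_deriv_pricing (W * (Wx + G))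
  -- The summands belong, in order, to the score error, the error of `ρ`, the error of `β`, and the
  -- error of `g'`.
  refine ⟨(Wx + G) + K * (Wx + G) / m * (W * G) + G + W * G * (K * (Wx + G)), by positivity, ?_⟩
  intro d B l₀ Ca θ₀ θ Γ τ s hCa hs hθ₀ hθ hΓ t ht hne
  have hΔ := euclNorm_nonneg (θ - θ₀)
  unfold exploitPrice oraclePrice
  split_ifs with h1 h2
  · rw [hs.recordedTrue_eq h1]
    refine (hν.abs_pricing_sub_le _ _).trans ((abs_score_sub_score_le _ _ _).trans ?_)
    rw [mul_comm]
    refine mul_le_mul_of_nonneg_right ((hs.feat_le t).trans ?_) hΔ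
    have : 0 ≤ G + K * (Wx + G) / m * (W * G) + G + W * G * (K * (Wx + G)) := by positivity
    linarith
  · obtain ⟨ρ, hρ, hρ'⟩ := hs.exists_gammaHat_eq hν hCa hθ₀ hθ hΓ hm hK hlow hlip h2
    refine (hν.abs_pricing_sub_le _ _).trans ?_
    have hx : euclNorm (aug (s.manip t)) ≤ Wx + G :=
      (hs.euclNorm_aug_manip_le hν ht).trans (by gcongr)
    set x := s.manip t with hxdef
    set u := deriv (pricing ν) (score θ x) with hu
    set w := deriv (pricing ν) (score θ₀ x) with hw
    have hu0 := hν.deriv_pricing_pos (score θ x)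
    have hu1 := hν.deriv_pricing_le_one (score θ x)
    have hfeat : s.feat t = x - (-w) • Γ := by
      have := hs.manip_eq t ht
      rw [← hxdef, ← hw] at this
      rw [this]; simp
    have hsx : |score θ x - score θ₀ x| ≤ (Wx + G) * euclNorm (θ - θ₀) := by
      refine (abs_score_sub_score_le _ _ _).trans ?_
      rw [mul_comm]
      exact mul_le_mul_of_nonneg_right hx hΔ
    have huw : |u - w| ≤ K * (Wx + G) * euclNorm (θ - θ₀) := by
      refine (hlip _ _ (abs_score_le_of_mem_paramSet _ hθ hx)
        (abs_score_le_of_mem_paramSet _ hθ₀ hx)).trans ?_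
      rw [mul_assoc]
      exact mul_le_mul_of_nonneg_left hsx hK.le
    have hβ : ∀ θ' ∈ paramSet d W, |betaPart θ' ⬝ᵥ Γ| ≤ W * G := fun θ' h' =>
      (abs_dotProduct_le _ _).trans (mul_le_mul ((euclNorm_betaPart_le θ').trans
        (euclNorm_le_of_mem_paramSet h')) hΓ (euclNorm_nonneg _) hW.le)
    have hβΔ : |betaPart θ ⬝ᵥ Γ - betaPart θ₀ ⬝ᵥ Γ| ≤ G * euclNorm (θ - θ₀) := by
      rw [← sub_dotProduct, ← betaPart_sub, mul_comm]
      exact (abs_dotProduct_le _ _).trans (mul_le_mul (euclNorm_betaPart_le _) hΓ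
        (euclNorm_nonneg _) hΔ)
    rw [hρ, hfeat, score_sub_apply, dotProduct_smul, dotProduct_smul, smul_eq_mul, smul_eq_mul]
    set a := betaPart θ ⬝ᵥ Γ
    set a₀ := betaPart θ₀ ⬝ᵥ Γ
    -- The true score `θ₀ᵀ x⁰` equals `score θ₀ x + w a₀`. Telescoping replaces `ρ`, `a`, `u` one at
    -- a time by `1`, `a₀`, `w`.
    have e : score θ x - -ρ * a * u - (score θ₀ x - -w * a₀) =
        (score θ x - score θ₀ x) + (ρ - 1) * a * u + (a - a₀) * u + a₀ * (u - w) := by ring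
    rw [e]
    have b1 : |(ρ - 1) * a * u| ≤ K * (Wx + G) / m * euclNorm (θ - θ₀) * (W * G) := by
      rw [abs_mul, abs_mul, abs_of_pos hu0]
      refine (mul_le_of_le_one_right (by positivity) hu1).trans ?_
      exact mul_le_mul hρ' (hβ θ hθ) (abs_nonneg _) (by positivity)
    have b2 : |(a - a₀) * u| ≤ G * euclNorm (θ - θ₀) := by
      rw [abs_mul, abs_of_pos hu0]
      exact (mul_le_of_le_one_right (abs_nonneg _) hu1).trans hβΔ
    have b3 : |a₀ * (u - w)| ≤ W * G * (K * (Wx + G) * euclNorm (θ - θ₀)) := by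
      rw [abs_mul]
      exact mul_le_mul (hβ θ₀ hθ₀) huw (abs_nonneg _) (by positivity)
    have t1 := abs_add_le (score θ x - score θ₀ x + (ρ - 1) * a * u + (a - a₀) * u) (a₀ * (u - w))
    have t2 := abs_add_le (score θ x - score θ₀ x + (ρ - 1) * a * u) ((a - a₀) * u)
    have t3 := abs_add_le (score θ x - score θ₀ x) ((ρ - 1) * a * u)
    linarith
  · exact absurd hne (by simp [h1, h2])

/-- All prices are bounded. -/
theorem exists_abs_price_le {ν : Measure ℝ} (hν : NoiseAssumptions ν) {B Wx W G : ℝ}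
    (hB : 0 < B) (hWx : 0 < Wx) (hW : 0 < W) (hG : 0 < G) :
    ∃ C, 0 < C ∧ ∀ {d : ℕ} {l₀ : ℕ} {Ca : ℝ} {θ₀ : Fin (d + 1) → ℝ} {Γ : Fin d → ℝ}
      {τ : ℝ} {s : Path d}, 0 < l₀ → Ca ≤ l₀ → IsRegularPath ν B l₀ Ca θ₀ Γ Wx τ s →
      θ₀ ∈ paramSet d W → euclNorm Γ ≤ G →
      ∀ {est : (n : ℕ) → (Fin n → Obs d) → (Fin (d + 1) → ℝ)}, IsMLE ν W est →
      ∀ {t : ℕ}, l₀ ≤ t →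
      |oraclePrice ν θ₀ s t| ≤ C ∧ |price ν l₀ Ca est θ₀ s t| ≤ C := by
  obtain ⟨C, hC, hC'⟩ := exists_abs_exploitPrice_sub_le hν hWx hW hG
  obtain ⟨D, hD, hD'⟩ := hν.continuous_pricing.exists_abs_le_of_abs_le (W * (Wx + G))
  -- `D` covers the oracle price and the uncorrected price when there is no match, `D + C (2 W)` the
  -- corrected exploitation prices, and `B` the exploration prices.
  refine ⟨D + C * (2 * W) + B, by positivity, ?_⟩
  intro d l₀ Ca θ₀ Γ τ s h₀ hCa hs hθ₀ hΓ est hest t ht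
  have ho : |oraclePrice ν θ₀ s t| ≤ D := hD' _
    (abs_score_le_of_mem_paramSet _ hθ₀ ((hs.feat_le t).trans (by linarith)))
  have hCW : 0 ≤ C * (2 * W) := by positivity
  refine ⟨ho.trans (by linarith), ?_⟩
  unfold price
  split_ifs with hE
  · have := hs.unif_mem t
    rw [abs_of_pos this.1]
    linarith [this.2]
  · have hex : IsExploit l₀ Ca t := ⟨_, one_le_episodeOf, mem_exploitPhase_of_not_isExplore h₀ ht hE⟩
    set θ := thetaHat l₀ Ca est θ₀ s (episodeOf l₀ t) with hθdef
    have hθ : θ ∈ paramSet d W := hest.mem _ _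
    by_cases hne : (exploreRecords l₀ Ca s t).Nonempty ∨ (matchTimes l₀ Ca s t).Nonempty
    · have h1 := hC' hCa hs hθ₀ hθ hΓ hex hne
      have h2 : C * euclNorm (θ - θ₀) ≤ C * (2 * W) :=
        mul_le_mul_of_nonneg_left (euclNorm_sub_le_of_mem_paramSet hθ hθ₀) hC.le
      have h3 := abs_sub_abs_le_abs_sub (exploitPrice ν l₀ Ca θ s t) (oraclePrice ν θ₀ s t)
      linarith
    · rw [not_or] at hne
      unfold exploitPrice
      rw [if_neg hne.1, if_neg hne.2]
      have := hD' _ (abs_score_le_of_mem_paramSet _ hθ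
        ((hs.euclNorm_aug_manip_le hν hex).trans (by gcongr)))
      linarith

/-! # Measurability of the prices -/

section Measurability

variable {α β : Type*} [MeasurableSpace α] [MeasurableSpace β]

/-- There are only countably many finite sets of periods, so the domain splits into countably many
measurable fibres of `f`. -/
theorem measurable_comp_finset {f : α → Finset ℕ} (hf : ∀ r, MeasurableSet {a | r ∈ f a})
    {G : Finset ℕ → α → β} (hG : ∀ y, Measurable (G y)) : Measurable fun a => G (f a) a := by
  have hfib : ∀ y, MeasurableSet {a | f a = y} := fun y => by
    have : {a | f a = y} = ⋂ r, {a | r ∈ f a ↔ r ∈ y} := by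
      ext a; simp [Finset.ext_iff]
    rw [this]
    refine MeasurableSet.iInter fun r => ?_
    by_cases hr : r ∈ y
    · simpa [hr] using hf r
    · have : {a | r ∈ f a ↔ r ∈ y} = {a | r ∈ f a}ᶜ := by ext a; simp [hr]
      rw [this]
      exact (hf r).compl
  intro T hT
  have : (fun a => G (f a) a) ⁻¹' T = ⋃ y, {a | f a = y} ∩ G y ⁻¹' T := by
    ext a; simp
  rw [this]
  exact MeasurableSet.iUnion fun y => (hfib y).inter (hG y hT)

theorem measurableSet_finset_nonempty {f : α → Finset ℕ} (hf : ∀ r, MeasurableSet {a | r ∈ f a}) :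
    MeasurableSet {a | (f a).Nonempty} :=
  measurableSet_setOfPred.2 (measurable_comp_finset hf (G := fun y _ => y.Nonempty)
    fun _ => measurable_const)

variable {d : ℕ} {l₀ : ℕ} {Ca : ℝ}

theorem measurableSet_ident_eq (r t : ℕ) : MeasurableSet {s : Path d | s.ident r = s.ident t} :=
  measurableSet_eq_fun (Path.measurable_ident_apply r) (Path.measurable_ident_apply t)

theorem measurableSet_mem_exploreRecords (t r : ℕ) :
    MeasurableSet {s : Path d | r ∈ exploreRecords l₀ Ca s t} := by
  simp only [exploreRecords, Finset.mem_filter]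
  exact (MeasurableSet.const _).inter ((MeasurableSet.const _).inter (measurableSet_ident_eq r t))

theorem measurableSet_mem_exploitRecords (t r : ℕ) :
    MeasurableSet {s : Path d | r ∈ exploitRecords l₀ Ca s t} := by
  simp only [exploitRecords, Finset.mem_filter]
  exact (MeasurableSet.const _).inter ((MeasurableSet.const _).inter (measurableSet_ident_eq r t))

theorem measurableSet_mem_matchTimes (t r : ℕ) :
    MeasurableSet {s : Path d | r ∈ matchTimes l₀ Ca s t} := by
  simp only [matchTimes, Finset.mem_filter]
  exact (MeasurableSet.const _).inter
    (((MeasurableSet.const _).inter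
      (measurableSet_finset_nonempty (measurableSet_mem_exploreRecords r))).union
    ((MeasurableSet.const _).inter
      (measurableSet_finset_nonempty (measurableSet_mem_exploitRecords r))))

theorem measurable_recordedTrue (t : ℕ) :
    Measurable fun s : Path d => recordedTrue l₀ Ca s t :=
  measurable_comp_finset (measurableSet_mem_exploreRecords t)
    (G := fun y (s : Path d) => s.feat (y.sup id)) fun _ => Path.measurable_feat_apply _

theorem measurable_recordedManip (t : ℕ) :
    Measurable fun s : Path d => recordedManip l₀ Ca s t :=
  measurable_comp_finset (measurableSet_mem_exploitRecords t)
    (G := fun y (s : Path d) => s.manip (y.sup id)) fun _ => Path.measurable_manip_apply _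

theorem measurable_pairTrue (t : ℕ) : Measurable fun s : Path d => pairTrue l₀ Ca s t := by
  unfold pairTrue
  split_ifs
  exacts [Path.measurable_feat_apply t, measurable_recordedTrue t]

theorem measurable_pairManip (t : ℕ) : Measurable fun s : Path d => pairManip l₀ Ca s t := by
  unfold pairManip
  split_ifs
  exacts [measurable_recordedManip t, Path.measurable_manip_apply t]

variable {θ : Path d → Fin (d + 1) → ℝ}

theorem measurable_gammaHat (ν : Measure ℝ) (hθ : Measurable θ) (t : ℕ) :
    Measurable fun s : Path d => gammaHat ν l₀ Ca (θ s) s t := by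
  refine measurable_comp_finset (measurableSet_mem_matchTimes t)
    (G := fun N (s : Path d) =>
      (∑ r ∈ N, deriv (pricing ν) (score (θ s) (pairManip l₀ Ca s r)) ^ 2)⁻¹ •
      ∑ r ∈ N, deriv (pricing ν) (score (θ s) (pairManip l₀ Ca s r)) •
        (pairManip l₀ Ca s r - pairTrue l₀ Ca s r)) fun N => ?_
  have h1 : ∀ r, Measurable fun s : Path d =>
      deriv (pricing ν) (score (θ s) (pairManip l₀ Ca s r)) := fun r =>
    (measurable_deriv _).comp (hθ.score (measurable_pairManip r))
  exact (Finset.measurable_sum N fun r _ => (h1 r).pow_const 2).inv.smul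
    (Finset.measurable_sum N fun r _ =>
      (h1 r).smul ((measurable_pairManip r).sub (measurable_pairTrue r)))

theorem measurable_exploitPrice {ν : Measure ℝ} (hν : NoiseAssumptions ν) (hθ : Measurable θ)
    (t : ℕ) : Measurable fun s : Path d => exploitPrice ν l₀ Ca (θ s) s t := by
  have hg := hν.continuous_pricing.measurable
  have hm := hθ.score (Path.measurable_manip_apply t)
  have hβ : Measurable fun s => betaPart (θ s) ⬝ᵥ gammaHat ν l₀ Ca (θ s) s t := by
    have := measurable_gammaHat (l₀ := l₀) (Ca := Ca) ν hθ t
    unfold dotProduct betaPart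
    fun_prop
  unfold exploitPrice
  exact Measurable.ite (measurableSet_finset_nonempty (measurableSet_mem_exploreRecords t))
    (hg.comp (hθ.score (measurable_recordedTrue t)))
    (Measurable.ite (measurableSet_finset_nonempty (measurableSet_mem_matchTimes t))
      (hg.comp (hm.sub (hβ.mul ((measurable_deriv _).comp hm)))) (hg.comp hm))

theorem measurable_price {ν : Measure ℝ} (hν : NoiseAssumptions ν)
    {est : (n : ℕ) → (Fin n → Obs d) → (Fin (d + 1) → ℝ)} (hest : ∀ n, Measurable (est n))
    (θ₀ : Fin (d + 1) → ℝ) (t : ℕ) : Measurable fun s : Path d => price ν l₀ Ca est θ₀ s t := by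
  unfold price
  split_ifs
  · exact Path.measurable_unif_apply t
  · exact measurable_exploitPrice hν (measurable_thetaHat l₀ Ca hest θ₀ _) t

theorem measurable_oraclePrice {ν : Measure ℝ} (hν : NoiseAssumptions ν)
    (θ₀ : Fin (d + 1) → ℝ) (t : ℕ) : Measurable fun s : Path d => oraclePrice ν θ₀ s t :=
  hν.continuous_pricing.measurable.comp (measurable_const.score (Path.measurable_feat_apply t))

theorem _root_.Measurable.revenue {p v : α → ℝ} (hp : Measurable p) (hv : Measurable v) :
    Measurable fun a => revenue (p a) (v a) := by
  unfold StrategicPricing.revenue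
  exact Measurable.ite (measurableSet_le hp hv) hp measurable_const

end Measurability

theorem abs_revenue_le (p v : ℝ) : |revenue p v| ≤ |p| := by
  unfold revenue
  split_ifs <;> simp

/-! # The price does not depend on the present noise -/

/-- The path without the noise from period `t` on. -/
def Path.truncNoise {d : ℕ} (s : Path d) (t : ℕ) : Path d :=
  { s with noise := fun r => if r < t then s.noise r else 0 }

/-- The noise enters an exploitation price only through the sales of the exploration phase of the
same episode, which is over by then. Records and matched pairs are exogenous. -/
theorem price_truncNoise {d : ℕ} {ν : Measure ℝ} {l₀ : ℕ} {Ca : ℝ}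
    {est : (n : ℕ) → (Fin n → Obs d) → (Fin (d + 1) → ℝ)} {θ₀ : Fin (d + 1) → ℝ} (s : Path d)
    {t : ℕ} (h₀ : 0 < l₀) (ht : l₀ ≤ t) (hE : ¬IsExplore l₀ Ca t) :
    price ν l₀ Ca est θ₀ (s.truncNoise t) t = price ν l₀ Ca est θ₀ s t := by
  have h := (Finset.mem_Ico.1 (mem_exploitPhase_of_not_isExplore h₀ ht hE)).1
  have hdata : exploreData l₀ Ca θ₀ (s.truncNoise t) (episodeOf l₀ t) =
      exploreData l₀ Ca θ₀ s (episodeOf l₀ t) := by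
    funext i
    have hi : epLen l₀ (episodeOf l₀ t) + (i : ℕ) < t := by omega
    simp only [exploreData, valuation, Path.truncNoise, if_pos hi, Prod.mk.injEq, true_and]
    exact decide_eq_decide.2 Iff.rfl
  unfold price
  rw [if_neg hE, if_neg hE, thetaHat, hdata]
  rfl

/-! ### Averaging the revenue over the present noise. -/

namespace IsMarket

variable {Ω : Type*} [MeasurableSpace Ω] {μ : Measure Ω} {ν : Measure ℝ}
  {B : ℝ} {l₀ : ℕ} {Ca : ℝ} {d : ℕ} {A : Matrix (Fin d) (Fin d) ℝ} {θ₀ : Fin (d + 1) → ℝ}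
  {P : Measure (Fin d → ℝ)} {τ : ℝ} {S : Ω → Path d}

theorem indepFun_truncNoise [IsProbabilityMeasure μ] (H : IsMarket μ ν B l₀ Ca A θ₀ P τ S)
    (t : ℕ) : IndepFun (fun ω => (S ω).truncNoise t) (fun ω => (S ω).noise t) μ := by
  have h := (H.indepFun_noise_apply t).symm.comp
    (φ := fun q : (Finset.range t → ℝ) × (ℕ → ℝ) × (ℕ → ℕ) × (ℕ → Fin d → ℝ) × (ℕ → Fin d → ℝ) =>
      (⟨q.2.2.1, q.2.2.2.1, q.2.2.2.2,
        fun r => if h : r < t then q.1 ⟨r, Finset.mem_range.2 h⟩ else 0, q.2.1⟩ : Path d))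
    (ψ := id) (Path.measurable_mk (by fun_prop) (by fun_prop) (by fun_prop)
      (measurable_pi_lambda _ fun r => by split_ifs <;> fun_prop) (by fun_prop)) measurable_id
  refine h.congr (Filter.Eventually.of_forall fun ω => ?_) (Filter.Eventually.of_forall fun ω => rfl)
  simp [Path.truncNoise]

/-- Almost every path is regular. -/
theorem ae_isRegularPath (H : IsMarket μ ν B l₀ Ca A θ₀ P τ S) {Wx : ℝ}
    (hP : ∀ᵐ x ∂P, euclNorm (aug x) ≤ Wx) :
    ∀ᵐ ω ∂μ, IsRegularPath ν B l₀ Ca θ₀ (A⁻¹.mulVec (betaPart θ₀)) Wx τ (S ω) := by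
  have h1 := ae_all_iff.2 (H.ae_feat hP)
  have h2 := ae_all_iff.2 fun r => ae_all_iff.2 fun t => H.feat_ident r t
  have h3 : ∀ᵐ ω ∂μ, ∀ t, IsExploit l₀ Ca t → (S ω).manip t = (S ω).feat t -
      deriv (pricing ν) (score θ₀ ((S ω).manip t)) • (A⁻¹.mulVec (betaPart θ₀)) :=
    ae_all_iff.2 fun t => by
      by_cases ht : IsExploit l₀ Ca t
      · filter_upwards [H.manip_eq t ht] with ω hω _ using hω
      · exact Filter.Eventually.of_forall fun ω h => absurd h ht
  filter_upwards [h1, h2, h3, ae_all_iff.2 H.ae_unif_mem, H.repeat_rate] with ω h1 h2 h3 h4 h5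
  exact ⟨h1, h2, h3, h4, h5⟩

/-- The expected loss of revenue in an exploitation period. -/
theorem integral_revenue_sub_eq [IsProbabilityMeasure μ] [IsProbabilityMeasure ν]
    (H : IsMarket μ ν B l₀ Ca A θ₀ P τ S)
    (hν : NoiseAssumptions ν) {est : (n : ℕ) → (Fin n → Obs d) → (Fin (d + 1) → ℝ)}
    (hest : ∀ n, Measurable (est n)) {t : ℕ} (h₀ : 0 < l₀) (ht : l₀ ≤ t)
    (hE : ¬IsExplore l₀ Ca t)
    (hint : Integrable (fun ω => revenue (oraclePrice ν θ₀ (S ω) t) (valuation θ₀ (S ω) t) -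
      revenue (price ν l₀ Ca est θ₀ (S ω) t) (valuation θ₀ (S ω) t)) μ) :
    ∫ ω, (revenue (oraclePrice ν θ₀ (S ω) t) (valuation θ₀ (S ω) t) -
      revenue (price ν l₀ Ca est θ₀ (S ω) t) (valuation θ₀ (S ω) t)) ∂μ =
    ∫ ω, (oraclePrice ν θ₀ (S ω) t *
        (1 - noiseCDF ν (oraclePrice ν θ₀ (S ω) t - score θ₀ ((S ω).feat t))) -
      price ν l₀ Ca est θ₀ (S ω) t *
        (1 - noiseCDF ν (price ν l₀ Ca est θ₀ (S ω) t - score θ₀ ((S ω).feat t)))) ∂μ := by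
  have hS := H.measurable_path
  have htrunc : Measurable fun ω => (S ω).truncNoise t :=
    Path.measurable_mk (by fun_prop) (by fun_prop) (by fun_prop)
      (measurable_pi_lambda _ fun r => by
        split_ifs
        · exact H.measurable_noise r
        · exact measurable_const) (by fun_prop)
  set G : Path d × ℝ → ℝ := fun q =>
    revenue (oraclePrice ν θ₀ q.1 t) (score θ₀ (q.1.feat t) + q.2) -
      revenue (price ν l₀ Ca est θ₀ q.1 t) (score θ₀ (q.1.feat t) + q.2) with hG
  have hGm : Measurable G := by
    have hv : Measurable fun q : Path d × ℝ => score θ₀ (q.1.feat t) + q.2 :=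
      (measurable_const.score ((Path.measurable_feat_apply t).comp measurable_fst)).add
        measurable_snd
    exact (((measurable_oraclePrice hν θ₀ t).comp measurable_fst).revenue hv).sub
      (((measurable_price hν hest θ₀ t).comp measurable_fst).revenue hv)
  have hGS : ∀ ω z, G ((S ω).truncNoise t, z) =
      revenue (oraclePrice ν θ₀ (S ω) t) (score θ₀ ((S ω).feat t) + z) -
      revenue (price ν l₀ Ca est θ₀ (S ω) t) (score θ₀ ((S ω).feat t) + z) := fun ω z => by
    rw [hG]
    simp only
    rw [price_truncNoise (S ω) h₀ ht hE]
    rfl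
  -- Both prices and the score are functions of the truncated path, so only the noise of period `t`
  -- remains to be integrated.
  have h := (H.indepFun_truncNoise t).integral_comp_prodMk htrunc (H.measurable_noise t) hGm
    (by simp only [hGS]; exact hint)
  simp only [hGS, H.noise_law t] at h
  refine h.trans (integral_congr_ae (Filter.Eventually.of_forall fun ω => ?_))
  have hrev : ∀ p, Integrable (fun z => revenue p (score θ₀ ((S ω).feat t) + z)) ν := fun p =>
    Integrable.of_measurable_of_ae_abs_le (measurable_const.revenue (by fun_prop))
      (Filter.Eventually.of_forall fun z => abs_revenue_le p _)
  simp only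
  rw [integral_sub (hrev _) (hrev _), hν.integral_revenue, hν.integral_revenue]

end IsMarket

/-! # Summation over the periods -/

/-- Telescoping, since `1/√(T+1) ≤ 2 (√(T+1) - √T)`. -/
theorem sum_range_inv_sqrt_le (T : ℕ) : ∑ i ∈ Finset.range T, 1 / √((i : ℝ) + 1) ≤ 2 * √T := by
  induction T with
  | zero => simp
  | succ T ih =>
    rw [Finset.sum_range_succ]
    have h1 : (0 : ℝ) < √((T : ℝ) + 1) := Real.sqrt_pos.2 (by positivity)
    have h2 := Real.sq_sqrt (show (0 : ℝ) ≤ (T : ℝ) + 1 by positivity)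
    have h3 := Real.sq_sqrt (Nat.cast_nonneg (α := ℝ) T)
    have h4 : 1 / √((T : ℝ) + 1) ≤ 2 * √((T : ℝ) + 1) - 2 * √T := by
      rw [div_le_iff₀ h1]
      nlinarith [sq_nonneg (√((T : ℝ) + 1) - √T)]
    push_cast
    linarith

theorem sum_Ico_inv_sqrt_le {l₀ : ℕ} (h₀ : 0 < l₀) (T : ℕ) :
    ∑ t ∈ Finset.Ico l₀ (l₀ + T), 1 / √(t : ℝ) ≤ 2 * √T := by
  rw [Finset.sum_Ico_eq_sum_range, Nat.add_sub_cancel_left]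
  refine le_trans (Finset.sum_le_sum fun i _ => ?_) (sum_range_inv_sqrt_le T)
  have : (1 : ℝ) ≤ l₀ := Nat.one_le_cast.2 h₀
  push_cast
  refine one_div_le_one_div_of_le (Real.sqrt_pos.2 (by positivity)) (Real.sqrt_le_sqrt ?_)
  linarith

/-- If every period costs at most `a`, and every exploitation period from `2 l₀` on at most
`b / √t`, then `T` periods cost at most a constant times `√T`. -/
theorem sum_Ico_le_mul_sqrt {l₀ L : ℕ} {Ca a b : ℝ} (h₀ : 0 < l₀) (hL : l₀ ≤ L) (hCa : Ca ≤ l₀)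
    (ha : 0 ≤ a) (hb : 0 ≤ b) {r : ℕ → ℝ} (hr : ∀ t, l₀ ≤ t → r t ≤ a)
    (hr' : ∀ t, 2 * l₀ ≤ t → ¬IsExplore l₀ Ca t → r t ≤ b * (1 / √(t : ℝ))) {T : ℕ} (hT : 0 < T) :
    ∑ t ∈ Finset.Ico l₀ (l₀ + T), r t ≤ (a * (4 * (L + 1)) + a * L + b * 2) * √(T : ℝ) := by
  classical
  -- Exploration periods and the first episode are charged the trivial cost `a`, all others `b /
  -- √t`; the overlap is harmless because all charges are nonnegative.
  have hterm : ∀ t ∈ Finset.Ico l₀ (l₀ + T), r t ≤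
      a * (if IsExplore l₀ Ca t then 1 else 0) + a * (if t < 2 * l₀ then 1 else 0) +
        b * (1 / √(t : ℝ)) := fun t ht => by
    have h1 := hr t (Finset.mem_Ico.1 ht).1
    have h2 : 0 ≤ b * (1 / √(t : ℝ)) := by positivity
    split_ifs with hE hlt hlt
    · linarith
    · linarith
    · linarith
    · linarith [hr' t (not_lt.1 hlt) hE]
  refine (Finset.sum_le_sum hterm).trans ?_
  rw [Finset.sum_add_distrib, Finset.sum_add_distrib, ← Finset.mul_sum, ← Finset.mul_sum,
    ← Finset.mul_sum]
  have hT1 : (1 : ℝ) ≤ √(T : ℝ) := Real.one_le_sqrt.2 (Nat.one_le_cast.2 hT)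
  have hT1' : (1 : ℝ) ≤ T := Nat.one_le_cast.2 hT
  have hL' : (l₀ : ℝ) ≤ L := Nat.cast_le.2 hL
  have e1 : ∑ t ∈ Finset.Ico l₀ (l₀ + T), (if IsExplore l₀ Ca t then (1 : ℝ) else 0) ≤
      4 * (L + 1) * √(T : ℝ) := by
    rw [Finset.sum_boole]
    have h := card_isExplore_le (n := l₀ + T) h₀ hCa (Nat.le_add_right _ _)
    have h' : √((l₀ : ℝ) * (l₀ + T : ℕ)) ≤ (L + 1) * √(T : ℝ) := by
      rw [Real.sqrt_le_iff]
      refine ⟨by positivity, ?_⟩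
      rw [mul_pow, Real.sq_sqrt (Nat.cast_nonneg _)]
      push_cast
      have hl0 : (0 : ℝ) ≤ l₀ := Nat.cast_nonneg _
      calc (l₀ : ℝ) * (l₀ + T) ≤ L * (L * T + T) := by
            gcongr
            exact hL'.trans (le_mul_of_one_le_right (hl0.trans hL') hT1')
        _ ≤ (L + 1) ^ 2 * T := by nlinarith
    refine le_trans ?_ (h.trans ((mul_le_mul_of_nonneg_left h' (by norm_num)).trans_eq (by ring)))
    refine le_of_eq ?_
    congr!
  have e2 : ∑ t ∈ Finset.Ico l₀ (l₀ + T), (if t < 2 * l₀ then (1 : ℝ) else 0) ≤ L * √(T : ℝ) := by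
    rw [Finset.sum_boole]
    have hsub : (Finset.Ico l₀ (l₀ + T)).filter (fun t => t < 2 * l₀) ⊆ Finset.Ico l₀ (2 * l₀) :=
      fun t ht => by
        rw [Finset.mem_filter, Finset.mem_Ico] at ht
        exact Finset.mem_Ico.2 ⟨ht.1.1, ht.2⟩
    have h := Finset.card_le_card hsub
    rw [Nat.card_Ico] at h
    calc _ ≤ (L : ℝ) := Nat.cast_le.2 (by omega)
      _ ≤ L * √(T : ℝ) := le_mul_of_one_le_right (Nat.cast_nonneg _) hT1
  have e3 := sum_Ico_inv_sqrt_le h₀ T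
  have f1 := mul_le_mul_of_nonneg_left e1 ha
  have f2 := mul_le_mul_of_nonneg_left e2 ha
  have f3 := mul_le_mul_of_nonneg_left e3 hb
  linarith

end

end StrategicPricing


/-! ### The regret bound. -/

open StrategicPricing in
theorem theorem3 (ν : Measure ℝ) [IsProbabilityMeasure ν] (hν : NoiseAssumptions ν)
    (B Wx Wθ lmin lA₀ c : ℝ) (L : ℕ)
    (hB : 0 < B) (hWx : 0 < Wx) (hWθ : 0 < Wθ) (hlmin : 0 < lmin) (hlA₀ : 0 < lA₀) (hc : 0 < c) :
    ∃ C₃ C₄ : ℝ, 0 < C₃ ∧ 0 < C₄ ∧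
      ∀ (l₀ : ℕ) (Ca : ℝ), 0 < l₀ → l₀ ≤ L → c ≤ Ca → Ca ≤ (l₀ : ℝ) →
      ∀ (d : ℕ) (A : Matrix (Fin d) (Fin d) ℝ) (lA τ : ℝ), A.PosDef →
        IsLeast (spectrum ℝ A) lA → lA₀ ≤ lA → 0 < τ → τ ≤ 1 →
      ∀ θ₀ ∈ paramSet d Wθ,
      ∀ (P : Measure (Fin d → ℝ)) [IsProbabilityMeasure P],
        (∀ᵐ x ∂P, ‖WithLp.toLp 2 (aug x)‖ ≤ Wx) →
        (∀ l ∈ spectrum ℝ (secondMoment P), lmin ≤ l) →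
      ∀ (Ω : Type*) [MeasurableSpace Ω] (μ : Measure Ω) [IsProbabilityMeasure μ] (S : Ω → Path d),
        IsMarket μ ν B l₀ Ca A θ₀ P τ S →
      ∀ est : (n : ℕ) → (Fin n → Obs d) → (Fin (d + 1) → ℝ), IsMLE ν Wθ est →
      ∀ T : ℕ, 0 < T →
        Integrable (fun ω => regret ν l₀ Ca est θ₀ T (S ω)) μ ∧
        ∫ ω, regret ν l₀ Ca est θ₀ T (S ω) ∂μ <
          (C₃ + C₄ * √((d : ℝ) + 1) / (τ * lA ^ 2)) * √(((d : ℝ) + 1) * (T : ℝ)) := by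
  -- `G` bounds the manipulation direction `A⁻¹ β₀` uniformly over the admissible cost matrices.
  set G := Wθ / lA₀ with hGdef
  have hG : 0 < G := by positivity
  obtain ⟨Cp, hCp, hprice⟩ := exists_abs_price_le hν hB hWx hWθ hG
  obtain ⟨Ce, hCe, herr⟩ := exists_abs_exploitPrice_sub_le hν hWx hWθ hG
  obtain ⟨Cm, hCm, hmle⟩ := exists_integral_sq_thetaHat_le hν hB hWx hWθ hlmin
  obtain ⟨Cr, hCr, hrev⟩ := hν.exists_expected_revenue_sub_le (Cp + Wθ * Wx)
  set a := 2 * Cp with ha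
  set b := Cr * Ce ^ 2 * Cm / √(c / 2) with hb
  have hb0 : 0 ≤ b := by positivity
  set K := a * (4 * (L + 1)) + a * L + b * 2 with hK
  have hK0 : 0 ≤ K := by positivity
  -- `K √T` bounds the expected regret. The extra 1 makes the inequality strict, and any positive
  -- second constant would do.
  refine ⟨K + 1, 1, by positivity, one_pos, ?_⟩
  intro l₀ Ca h₀ hL hcCa hCa d A lA τ hA hlA hlA' hτ _ θ₀ hθ₀ P _ hP hl Ω _ μ _ S H est hest T hT
  set Γ := A⁻¹.mulVec (betaPart θ₀) with hΓdef
  have hΓ : euclNorm Γ ≤ G := by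
    refine (hA.euclNorm_inv_mulVec_le hlA₀ (fun l h => hlA'.trans (hlA.2 h)) _).trans ?_
    exact div_le_div_of_nonneg_right
      ((euclNorm_betaPart_le θ₀).trans (euclNorm_le_of_mem_paramSet hθ₀)) hlA₀.le
  have hreg : ∀ᵐ ω ∂μ, IsRegularPath ν B l₀ Ca θ₀ Γ Wx τ (S ω) := H.ae_isRegularPath hP
  have hS := H.measurable_path
  set r : ℕ → Ω → ℝ := fun t ω =>
    revenue (oraclePrice ν θ₀ (S ω) t) (valuation θ₀ (S ω) t) -
      revenue (price ν l₀ Ca est θ₀ (S ω) t) (valuation θ₀ (S ω) t) with hr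
  have hrm : ∀ t, Measurable (r t) := fun t =>
    (((measurable_oraclePrice hν θ₀ t).comp hS).revenue ((measurable_valuation θ₀ t).comp hS)).sub
      (((measurable_price hν hest.measurable θ₀ t).comp hS).revenue
        ((measurable_valuation θ₀ t).comp hS))
  have hrb : ∀ t, l₀ ≤ t → ∀ᵐ ω ∂μ, |r t ω| ≤ a := fun t ht => by
    filter_upwards [hreg] with ω hω
    obtain ⟨h1, h2⟩ := hprice h₀ hCa hω hθ₀ hΓ hest ht
    refine (abs_sub _ _).trans ?_
    have h3 := (abs_revenue_le (oraclePrice ν θ₀ (S ω) t) (valuation θ₀ (S ω) t)).trans h1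
    have h4 := (abs_revenue_le (price ν l₀ Ca est θ₀ (S ω) t) (valuation θ₀ (S ω) t)).trans h2
    linarith
  have hri : ∀ t, l₀ ≤ t → Integrable (r t) μ := fun t ht =>
    Integrable.of_measurable_of_ae_abs_le (hrm t) (hrb t ht)
  have hE1 : ∀ t, l₀ ≤ t → ∫ ω, r t ω ∂μ ≤ a := fun t ht =>
    integral_le_of_ae_le (hri t ht) ((hrb t ht).mono fun ω h => (le_abs_self _).trans h)
  have hE2 : ∀ t, 2 * l₀ ≤ t → ¬IsExplore l₀ Ca t →
      ∫ ω, r t ω ∂μ ≤ b * (1 / √(t : ℝ)) := fun t ht hE => by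
    have ht' : l₀ ≤ t := by omega
    have hex := mem_exploitPhase_of_not_isExplore h₀ ht' hE
    set k := episodeOf l₀ t with hk
    have hk1 : 1 ≤ k := one_le_episodeOf
    rw [H.integral_revenue_sub_eq hν hest.measurable h₀ ht' hE (hri t ht')]
    have hpt : ∀ᵐ ω ∂μ, oraclePrice ν θ₀ (S ω) t *
        (1 - noiseCDF ν (oraclePrice ν θ₀ (S ω) t - score θ₀ ((S ω).feat t))) -
      price ν l₀ Ca est θ₀ (S ω) t *
        (1 - noiseCDF ν (price ν l₀ Ca est θ₀ (S ω) t - score θ₀ ((S ω).feat t))) ≤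
        Cr * Ce ^ 2 * euclNorm (thetaHat l₀ Ca est θ₀ (S ω) k - θ₀) ^ 2 := by
      filter_upwards [hreg] with ω hω
      obtain ⟨h1, h2⟩ := hprice h₀ hCa hω hθ₀ hΓ hest ht'
      have h3 := abs_score_le_of_mem_paramSet _ hθ₀ (hω.feat_le t)
      have h4 := herr hCa hω hθ₀ (hest.mem _ (exploreData l₀ Ca θ₀ (S ω) k)) hΓ ⟨k, hk1, hex⟩
        (Or.inr (hω.matchTimes_nonempty h₀ hCa hτ ht))
      have h5 : price ν l₀ Ca est θ₀ (S ω) t =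
          exploitPrice ν l₀ Ca (thetaHat l₀ Ca est θ₀ (S ω) k) (S ω) t := if_neg hE
      refine (hrev (price ν l₀ Ca est θ₀ (S ω) t) (score θ₀ ((S ω).feat t))
        ((abs_sub _ _).trans (add_le_add h2 h3)) ((abs_sub _ _).trans (add_le_add h1 h3))).trans ?_
      rw [mul_assoc, ← mul_pow]
      refine mul_le_mul_of_nonneg_left ?_ hCr.le
      rw [h5, ← sq_abs]
      exact pow_le_pow_left₀ (abs_nonneg _) h4 2
    have hmeas : Measurable fun ω => euclNorm (thetaHat l₀ Ca est θ₀ (S ω) k - θ₀) ^ 2 :=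
      (measurable_euclNorm.comp
        (((measurable_thetaHat l₀ Ca hest.measurable θ₀ k).comp hS).sub_const θ₀)).pow_const 2
    have hint : Integrable (fun ω => euclNorm (thetaHat l₀ Ca est θ₀ (S ω) k - θ₀) ^ 2) μ :=
      Integrable.of_measurable_of_ae_abs_le hmeas (K := (2 * Wθ) ^ 2)
        (Filter.Eventually.of_forall fun ω => by
          rw [abs_of_nonneg (sq_nonneg _)]
          exact pow_le_pow_left₀ (euclNorm_nonneg _) (euclNorm_sub_le_of_mem_paramSet
            (hest.mem _ (exploreData l₀ Ca θ₀ (S ω) k)) hθ₀) 2)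
    have h1 : ∫ ω, Cr * Ce ^ 2 * euclNorm (thetaHat l₀ Ca est θ₀ (S ω) k - θ₀) ^ 2 ∂μ ≤
        Cr * Ce ^ 2 * (Cm / ((exploreLen l₀ Ca k : ℝ) + 1)) := by
      rw [integral_const_mul]
      exact mul_le_mul_of_nonneg_left (hmle H hθ₀ hP hl hest hk1) (by positivity)
    -- From `t < 2 ℓ_k` and `Ca ≥ c` one gets `(c/2) t ≤ Ca ℓ_k`; the `+ 1` absorbs the rounding in
    -- `a_k`.
    have h2 : √(c / 2) * √(t : ℝ) ≤ (exploreLen l₀ Ca k : ℝ) + 1 := by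
      rw [← Real.sqrt_mul (by positivity)]
      refine le_trans (Real.sqrt_le_sqrt ?_) (Nat.lt_floor_add_one (√(Ca * (epLen l₀ k : ℝ)))).le
      have h3 := (mem_episodeOf h₀ ht').2
      rw [epLen_succ hk1] at h3
      have h4 : (t : ℝ) ≤ 2 * epLen l₀ k := by exact_mod_cast h3.le
      calc c / 2 * t ≤ c / 2 * (2 * epLen l₀ k) := by gcongr
        _ = c * epLen l₀ k := by ring
        _ ≤ Ca * epLen l₀ k := by gcongr
    have ht0 : (0 : ℝ) < t := Nat.cast_pos.2 (h₀.trans_le ht')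
    have h3 : Cr * Ce ^ 2 * (Cm / ((exploreLen l₀ Ca k : ℝ) + 1)) ≤ b * (1 / √(t : ℝ)) := by
      calc _ ≤ Cr * Ce ^ 2 * (Cm / (√(c / 2) * √(t : ℝ))) := by gcongr
        _ = b * (1 / √(t : ℝ)) := by rw [hb]; field_simp
    have hmul : ∀ p u, |p| ≤ Cp → |p * (1 - noiseCDF ν u)| ≤ Cp := fun p u hp => by
      rw [abs_mul, abs_of_pos (sub_pos.2 (hν.cdf_lt_one u))]
      exact (mul_le_of_le_one_right (abs_nonneg p) (by linarith [hν.cdf_pos u])).trans hp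
    have hi : Integrable (fun ω => oraclePrice ν θ₀ (S ω) t *
        (1 - noiseCDF ν (oraclePrice ν θ₀ (S ω) t - score θ₀ ((S ω).feat t))) -
      price ν l₀ Ca est θ₀ (S ω) t *
        (1 - noiseCDF ν (price ν l₀ Ca est θ₀ (S ω) t - score θ₀ ((S ω).feat t)))) μ := by
      have hq : Measurable fun ω => score θ₀ ((S ω).feat t) :=
        measurable_const.score (H.measurable_feat t)
      have ho := (measurable_oraclePrice hν θ₀ t).comp hS
      have hp := (measurable_price (l₀ := l₀) (Ca := Ca) hν hest.measurable θ₀ t).comp hS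
      have hF := hν.continuous_cdf.measurable
      refine Integrable.of_measurable_of_ae_abs_le (K := Cp + Cp)
        ((ho.mul (measurable_const.sub (hF.comp (ho.sub hq)))).sub
          (hp.mul (measurable_const.sub (hF.comp (hp.sub hq))))) ?_
      filter_upwards [hreg] with ω hω
      obtain ⟨h1, h2⟩ := hprice h₀ hCa hω hθ₀ hΓ hest ht'
      exact (abs_sub _ _).trans (add_le_add (hmul _ _ h1) (hmul _ _ h2))
    exact (integral_mono_ae hi (hint.const_mul _) hpt).trans (h1.trans h3)
  have hsum := sum_Ico_le_mul_sqrt h₀ hL hCa (by positivity) hb0 hE1 hE2 hT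
  refine ⟨integrable_finsetSum _ fun t ht => hri t (Finset.mem_Ico.1 ht).1, ?_⟩
  have hregret : ∫ ω, regret ν l₀ Ca est θ₀ T (S ω) ∂μ ≤ K * √(T : ℝ) := by
    unfold regret
    rw [integral_finsetSum _ fun t ht => hri t (Finset.mem_Ico.1 ht).1]
    exact hsum
  have hT0 : 0 < √(T : ℝ) := Real.sqrt_pos.2 (Nat.cast_pos.2 hT)
  have hd1 : 1 ≤ √((d : ℝ) + 1) := Real.one_le_sqrt.2 (by linarith [Nat.cast_nonneg (α := ℝ) d])
  have hlA0 : 0 < lA := hlA₀.trans_le hlA'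
  -- Only `√(d + 1) ≥ 1` and the nonnegativity of the second term are needed to pass to the stated
  -- form.
  calc _ ≤ K * √(T : ℝ) := hregret
    _ < (K + 1) * √(T : ℝ) := by gcongr; linarith
    _ ≤ (K + 1 + 1 * √((d : ℝ) + 1) / (τ * lA ^ 2)) * (√((d : ℝ) + 1) * √(T : ℝ)) := by
      refine mul_le_mul ?_ (le_mul_of_one_le_left hT0.le hd1) hT0.le (by positivity)
      exact le_add_of_nonneg_right (by positivity)
    _ = _ := by rw [← Real.sqrt_mul (by positivity)]
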